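/- Ribbon (framed) tangles in $\mathbb{R}^2\times[0,1]$ are represented by plane diagrams with the blackboard framing. A $(p,q)$-tangle diagram has $p$ bottom and $q$ top endpoints and is read from bottom to top; it is a vertical composite of slices, each consisting of vertical strands and one local minimum, one local maximum or one crossing. *Isotopy classes* of ribbon tangles are diagrams modulo deformation (exchange of the heights of distant pieces, straightening of zigzags, moving a strand across a local extremum) and ribbon Reidemeister moves (the framed move of type 1, which exchanges a right and a left curl of the same framing, and the moves of types 2 and 3). A *ribbon $n$-string link* is a ribbon $(n,n)$-tangle consisting of $n$ arcs, without closed component, the $k$-th arc joining the $k$-th bottom endpoint to the $k$-th top endpoint. A *ribbon $n$-handle* is a ribbon $(2n,0)$-tangle consisting of $n$ arcs, without closed component, the $k$-th arc joining the $(2k-1)$-th bottom endpoint to the $2k$-th bottom endpoint. Let $\mathrm{RSL}_n$ and $\mathrm{RHand}_n$ be the sets of isotopy classes of ribbon $n$-string links and ribbon $n$-handles. Fix one of the two words "behind" / "in front of" and use it throughout in place of "behind" below. * $\mathrm{RSL}$ has the non-negative integers as objects, $\mathrm{Hom}(n,n)=\mathrm{RSL}_n$ and $\mathrm{Hom}(m,n)=\emptyset$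 for $m\ne n$. The composite $S'\circ S$ is $S'$ stacked on top of $S$, the identities are the trivial string links, and $m\otimes n=m+n$, with $S\otimes S'$ given by juxtaposition ($S$ on the left of $S'$). * $\mathrm{RHand}$ has the non-negative integers as objects, $\mathrm{Hom}(n,n)=\mathrm{RHand}_n$ and $\mathrm{Hom}(m,n)=\emptyset$ for $m\ne n$. For $T,T'\in\mathrm{RHand}_n$ the composite $T\circ T'$ is obtained as follows: between the two strands $L_k,R_k$ starting at the $k$-th pair of bottom endpoints insert a local minimum with left end $c_k$ and right end $c_k'$; move the pairs of strands $(L_k,c_k)$ to the left, in order, $(L_k,c_k)$ passing behind $(c_j',R_j)$ for $j<k$; then put $T$ on top of $(L_1,c_1),\dots,(L_n,c_n)$ and $T'$ on top of $(c_1',R_1),\dots,(c_n',R_n)$. The identity of $n$ consists of $n$ caps side by side, and $m\otimes n=m+n$, with $T\otimes T'$ given by juxtaposition ($T$ on the left of $T'$). * $F$ and $G$ are the identity on objects. For $S\in\mathrm{RSL}_n$, $F(S)\in\mathrm{RHand}_n$ is obtained by letting the $2k$-th bottom endpoint run into the $k$-th input of $S$, and bending the $k$-th output of $S$ to the left by a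 local maximum and bringing it down behind $S$ to the $(2k-1)$-th bottom endpoint. For $T\in\mathrm{RHand}_n$, $G(T)\in\mathrm{RSL}_n$ is obtained by letting the $k$-th bottom endpoint run into the $2k$-th input of $T$, and bending the $(2k-1)$-th input strand of $T$ to the left by a local minimum and bringing it up behind $T$ to the $k$-th top endpoint. **Proposition.** With these operations $\mathrm{RSL}$ and $\mathrm{RHand}$ are strict monoidal categories, $F\colon\mathrm{RSL}\to\mathrm{RHand}$ and $G\colon\mathrm{RHand}\to\mathrm{RSL}$ are (strict) monoidal functors, and they are mutually inverse: $G\circ F=1_{\mathrm{RSL}}$ and $F\circ G=1_{\mathrm{RHand}}$. -/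

import Mathlib

open CategoryTheory MonoidalCategory

namespace RibbonTangle

/-! ### Plane diagrams of ribbon tangles

Ribbon (that is, framed) tangles in `ℝ² × [0, 1]` are represented by plane diagrams with the
blackboard framing, and isotopy classes of ribbon tangles are diagrams up to deformation and ribbon
Reidemeister moves.  A diagram in the strip, in general position with respect to the height, is read
from bottom to top as a finite list of slices, each of which contains one crossing or one local extremum.
-/

/-- The elementary pieces: `cup` is a local minimum, `cap` is a local maximum, and `cross b` is a
crossing of two strands; the strand going from the bottom left to the top right passes in front of
the other one if `b = true` and behind it if `b = false`. -/
inductive Piece : Type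
  | cup : Piece
  | cap : Piece
  | cross (b : Bool) : Piece

/-- The number of inputs (bottom ends) of an elementary piece. -/
def Piece.ins : Piece → ℕ
  | cup => 0
  | cap => 2
  | cross _ => 2

/-- The number of outputs (top ends) of an elementary piece. -/
def Piece.outs : Piece → ℕ
  | cup => 2
  | cap => 0
  | cross _ => 2

/-- The mirror image of an elementary piece in a horizontal plane. -/
def Piece.flip : Piece → Piece
  | cup => cap
  | cap => cup
  | cross b => cross (!b)

/-- A horizontal slice of a diagram: the elementary piece `piece` with `pos` vertical strands on its
left, and any number of vertical strands on its right. -/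
structure Layer : Type where
  pos : ℕ
  piece : Piece

/-- The slices of a diagram, from bottom to top. -/
abbrev Word : Type := List Layer

/-- `IsDiagram m w n`: the slices `w` form a plane diagram with `m` bottom endpoints and `n` top
endpoints. -/
inductive IsDiagram : ℕ → Word → ℕ → Prop
  | nil (n : ℕ) : IsDiagram n [] n
  | cons (l r : ℕ) (p : Piece) (w : Word) (n : ℕ) :
      IsDiagram (l + p.outs + r) w n → IsDiagram (l + p.ins + r) (⟨l, p⟩ :: w) n

/-- The elementary moves on diagrams: deformation of plane diagrams in the strip (exchange of the
heights of two distant pieces, straightening of a zigzag, moving a strand across a local extremum)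
and the ribbon Reidemeister moves of type 1 (framed version: it exchanges a curl on the right and a
curl on the left with the same framing), 2 and 3.  Moves are used in both directions. -/
inductive Move : Word → Word → Prop
  | exchange (i d : ℕ) (p q : Piece) :
      Move [⟨i, p⟩, ⟨i + p.outs + d, q⟩] [⟨i + p.ins + d, q⟩, ⟨i, p⟩]
  | zigzag_left (i : ℕ) : Move [⟨i, .cup⟩, ⟨i + 1, .cap⟩] []
  | zigzag_right (i : ℕ) : Move [⟨i + 1, .cup⟩, ⟨i, .cap⟩] []
  | slide_cap (i : ℕ) (b : Bool) :
      Move [⟨i, .cross b⟩, ⟨i + 1, .cap⟩] [⟨i + 1, .cross (!b)⟩, ⟨i, .cap⟩]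
  | slide_cup (i : ℕ) (b : Bool) :
      Move [⟨i + 1, .cup⟩, ⟨i, .cross b⟩] [⟨i, .cup⟩, ⟨i + 1, .cross (!b)⟩]
  | reidemeister_one (i : ℕ) (b : Bool) :
      Move [⟨i + 1, .cup⟩, ⟨i, .cross b⟩, ⟨i + 1, .cap⟩] [⟨i, .cup⟩, ⟨i + 1, .cross b⟩, ⟨i, .cap⟩]
  | reidemeister_two (i : ℕ) (b : Bool) : Move [⟨i, .cross b⟩, ⟨i, .cross (!b)⟩] []
  | reidemeister_three (i : ℕ) (b : Bool) :
      Move [⟨i, .cross b⟩, ⟨i + 1, .cross b⟩, ⟨i, .cross b⟩]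
        [⟨i + 1, .cross b⟩, ⟨i, .cross b⟩, ⟨i + 1, .cross b⟩]

/-- Diagrams with `m` bottom endpoints and `n` top endpoints. -/
def Diagram (m n : ℕ) : Type := {w : Word // IsDiagram m w n}

/-- One diagram is obtained from the other by an elementary move on consecutive slices. -/
def Step {m n : ℕ} (D E : Diagram m n) : Prop :=
  ∃ u x y v : Word, Move x y ∧ D.1 = u ++ x ++ v ∧ E.1 = u ++ y ++ v

/-- Isotopy classes of ribbon `(m, n)`-tangles: diagrams up to the equivalence relation generated by
the elementary moves. -/
def Tangle (m n : ℕ) : Type := Quot (Step (m := m) (n := n))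

/-! ### Components -/

/-- Let `(l, q)` be the `q`-th point (from the left, starting from `0`) on the horizontal line just
below the `l`-th slice of `w` (on the top line if `l = w.length`).  Two such points are adjacent if
they bound a strand inside a slice. -/
inductive Adj (w : Word) : ℕ × ℕ → ℕ × ℕ → Prop
  | left {l i q : ℕ} {p : Piece} : w[l]? = some ⟨i, p⟩ → q < i → Adj w (l, q) (l + 1, q)
  | right {l i : ℕ} {p : Piece} (r : ℕ) : w[l]? = some ⟨i, p⟩ →
      Adj w (l, i + p.ins + r) (l + 1, i + p.outs + r)
  | cup {l i : ℕ} : w[l]? = some ⟨i, .cup⟩ → Adj w (l + 1, i) (l + 1, i + 1)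
  | cap {l i : ℕ} : w[l]? = some ⟨i, .cap⟩ → Adj w (l, i) (l, i + 1)
  | cross_right {l i : ℕ} {b : Bool} : w[l]? = some ⟨i, .cross b⟩ → Adj w (l, i) (l + 1, i + 1)
  | cross_left {l i : ℕ} {b : Bool} : w[l]? = some ⟨i, .cross b⟩ → Adj w (l, i + 1) (l + 1, i)

/-- Two points lie on the same component of the tangle. -/
def Conn (w : Word) : ℕ × ℕ → ℕ × ℕ → Prop := Relation.EqvGen (Adj w)

/-- `P` is one of the points on the horizontal lines of the diagram `w` with `m` bottom endpoints. -/
def IsPoint (m : ℕ) (w : Word) (P : ℕ × ℕ) : Prop :=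
  P.1 ≤ w.length ∧ ∃ k, IsDiagram m (w.take P.1) k ∧ P.2 < k

/-- Diagrams of ribbon `n`-string links: the `k`-th bottom endpoint is joined to the `k`-th top
endpoint, and there is no closed component. -/
def IsStringLink (n : ℕ) (w : Word) : Prop :=
  IsDiagram n w n ∧ (∀ k < n, Conn w (0, k) (w.length, k)) ∧
    ∀ P, IsPoint n w P → ∃ k < n, Conn w P (0, k)

/-- Diagrams of ribbon `n`-handles: the two bottom endpoints of the `k`-th pair are joined, and there
is no closed component. -/
def IsHandle (n : ℕ) (w : Word) : Prop :=
  IsDiagram (2 * n) w 0 ∧ (∀ k < n, Conn w (0, 2 * k) (0, 2 * k + 1)) ∧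
    ∀ P, IsPoint (2 * n) w P → ∃ k < 2 * n, Conn w P (0, k)

/-- Isotopy classes of ribbon `n`-string links. -/
def RSL (n : ℕ) : Type :=
  {t : Tangle n n // ∃ D : Diagram n n, IsStringLink n D.1 ∧ Quot.mk _ D = t}

/-- Isotopy classes of ribbon `n`-handles.  (The parameter `side` is used only for the choice of the
composition below.) -/
def RHand (_side : Bool) (n : ℕ) : Type :=
  {t : Tangle (2 * n) 0 // ∃ D : Diagram (2 * n) 0, IsHandle n D.1 ∧ Quot.mk _ D = t}

/-! ### Operations on diagrams -/

/-- Add `s` vertical strands on the left. -/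
def shift (s : ℕ) (w : Word) : Word := w.map fun x => ⟨s + x.pos, x.piece⟩

/-- The mirror image of a diagram in a horizontal plane; for a braid, its inverse. -/
def flip (w : Word) : Word := (w.map fun x => ⟨x.pos, x.piece.flip⟩).reverse

/-- The strand at position `i + x` moves left across the strands at positions `i, …, i + x - 1`,
behind them if `side = true`, in front of them if `side = false`. -/
def strandLeft (side : Bool) (i : ℕ) : ℕ → Word
  | 0 => []
  | x + 1 => ⟨i + x, .cross side⟩ :: strandLeft side i x

/-- The `y` parallel strands at positions `i + x, …, i + x + y - 1` move left across the `x` parallel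
strands at positions `i, …, i + x - 1`, behind or in front of them according to `side`. -/
def block (side : Bool) (i x : ℕ) : ℕ → Word
  | 0 => []
  | y + 1 => block side i x y ++ strandLeft side (i + y) x

/-- The braid from `A₁ B₁ A₂ B₂ … Aₙ Bₙ` to `A₁ A₂ … Aₙ B₁ B₂ … Bₙ`, where each `Aₖ` consists of `p`
parallel strands and each `Bₖ` of `q` parallel strands, and the strands of `Aₖ` pass behind
(`side = true`) or in front of (`side = false`) the strands of `B₁, …, Bₖ₋₁`. -/
def unshuffle (side : Bool) (p q : ℕ) : ℕ → Word
  | 0 => []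
  | n + 1 => unshuffle side p q n ++ block side (n * p) (n * q) p

/-- Start from `n` groups of `r` vertical strands, and insert in each of them a local minimum, with
`o` strands of the group on its left. -/
def insertCups (r o : ℕ) : ℕ → Word
  | 0 => []
  | n + 1 => insertCups r o n ++ [⟨n * (r + 2) + o, .cup⟩]

/-- `n` local maxima side by side. -/
def caps (n : ℕ) : Word := List.replicate n ⟨0, .cap⟩

/-- Composition of handles `T ∘ T'`.  The `k`-th pair of inputs `Lₖ Rₖ` is split by inserting a local
minimum with ends `cₖ c'ₖ`; the pairs `Lₖ cₖ` are connected to the inputs of `T` and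
the pairs `c'ₖ Rₖ` to the inputs of `T'`, where `T` is placed on the left of `T'`. -/
def handleCompWord (side : Bool) (n : ℕ) (T T' : Word) : Word :=
  insertCups 2 1 n ++ unshuffle side 2 2 n ++ T ++ T'

/-- The handle `F(S)`: the `k`-th bottom end of `S` is the input `2k`, and the `k`-th top end of `S` is
bent to the left by a local maximum and goes down behind `S` (in front of `S` if `side = false`) to the
input `2k - 1`. -/
def bendWord (side : Bool) (n : ℕ) (S : Word) : Word :=
  unshuffle side 1 1 n ++ shift n S ++ flip (unshuffle side 1 1 n) ++ caps n

/-- The string link `G(T)`: the input `2k` of `T` is the `k`-th bottom endpoint, and the input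
`2k - 1` of `T` is bent to the left by a local minimum and goes up behind `T` (in front of `T` if
`side = false`) to the `k`-th top endpoint. -/
def unbendWord (side : Bool) (n : ℕ) (T : Word) : Word :=
  insertCups 1 0 n ++ unshuffle side 1 2 n ++ shift n T

/-! ### The operations are well defined on isotopy classes of tangles -/

theorem IsDiagram.append {a b c : ℕ} {u v : Word} (hu : IsDiagram a u b) (hv : IsDiagram b v c) :
    IsDiagram a (u ++ v) c := by
  induction hu with
  | nil n => exact hv
  | cons l r p w n _ ih => exact IsDiagram.cons l r p _ _ (ih hv)

theorem IsDiagram.cast {a a' b b' : ℕ} {u : Word} (hu : IsDiagram a u b) (ha : a = a')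
    (hb : b = b') : IsDiagram a' u b' := by
  subst ha hb; exact hu

theorem IsDiagram.single {a b : ℕ} (l r : ℕ) (p : Piece) (ha : a = l + p.ins + r)
    (hb : b = l + p.outs + r) : IsDiagram a [⟨l, p⟩] b := by
  subst ha hb; exact IsDiagram.cons l r p _ _ (IsDiagram.nil _)

theorem IsDiagram.addRight {a b : ℕ} {u : Word} (hu : IsDiagram a u b) (e : ℕ) :
    IsDiagram (a + e) u (b + e) := by
  induction hu with
  | nil n => exact IsDiagram.nil _
  | cons l r p w n _ ih =>
    rw [Nat.add_assoc]
    refine IsDiagram.cons l (r + e) p w _ ?_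
    rwa [← Nat.add_assoc]

theorem IsDiagram.shift {a b : ℕ} {u : Word} (hu : IsDiagram a u b) (s : ℕ) :
    IsDiagram (s + a) (shift s u) (s + b) := by
  induction hu with
  | nil n => exact IsDiagram.nil _
  | cons l r p w n _ ih =>
    have : IsDiagram (s + l + p.ins + r) (⟨s + l, p⟩ :: RibbonTangle.shift s w) (s + n) :=
      IsDiagram.cons (s + l) r p _ _ (ih.cast (by omega) rfl)
    exact this.cast (by omega) rfl

theorem Piece.ins_flip (p : Piece) : p.flip.ins = p.outs := by cases p <;> rfl

theorem Piece.outs_flip (p : Piece) : p.flip.outs = p.ins := by cases p <;> rfl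

theorem IsDiagram.flip {a b : ℕ} {u : Word} (hu : IsDiagram a u b) :
    IsDiagram b (flip u) a := by
  induction hu with
  | nil n => exact IsDiagram.nil _
  | cons l r p w n _ ih =>
    have h : RibbonTangle.flip (⟨l, p⟩ :: w) = RibbonTangle.flip w ++ [⟨l, p.flip⟩] := by
      simp [RibbonTangle.flip]
    rw [h]
    exact ih.append (IsDiagram.single l r p.flip (by rw [p.ins_flip]) (by rw [p.outs_flip]))

theorem isDiagram_strandLeft (side : Bool) (i x : ℕ) :
    IsDiagram (i + x + 1) (strandLeft side i x) (i + x + 1) := by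
  induction x with
  | zero => exact IsDiagram.nil _
  | succ x ih =>
    exact (IsDiagram.cons (i + x) 0 (.cross side) _ _
      ((ih.addRight 1).cast (by simp [Piece.outs]) rfl)).cast
        (by simp [Piece.ins]; omega) (by omega)

theorem isDiagram_block (side : Bool) (i x y : ℕ) :
    IsDiagram (i + x + y) (block side i x y) (i + x + y) := by
  induction y with
  | zero => exact IsDiagram.nil _
  | succ y ih =>
    exact (ih.addRight 1).append ((isDiagram_strandLeft side (i + y) x).cast (by omega) (by omega))

theorem isDiagram_unshuffle (side : Bool) (p q n : ℕ) :
    IsDiagram (n * (p + q)) (unshuffle side p q n) (n * (p + q)) := by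
  induction n with
  | zero => exact (IsDiagram.nil 0).cast (by simp) (by simp)
  | succ n ih =>
    exact ((ih.addRight (p + q)).append
      (((isDiagram_block side (n * p) (n * q) p).addRight q).cast (by ring) rfl)).cast
        (by ring) (by ring)

theorem isDiagram_insertCups (r o n : ℕ) (h : o ≤ r) :
    IsDiagram (n * r) (insertCups r o n) (n * (r + 2)) := by
  induction n with
  | zero => exact (IsDiagram.nil 0).cast (by simp) (by simp)
  | succ n ih =>
    refine ((ih.addRight r).append (IsDiagram.single (n * (r + 2) + o) (r - o) .cup ?_ rfl)).cast
        (by ring) ?_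
    · simp only [Piece.ins]; omega
    · simp only [Piece.outs]
      have : (n + 1) * (r + 2) = n * (r + 2) + (r + 2) := by ring
      omega

theorem isDiagram_caps (n : ℕ) : IsDiagram (2 * n) (caps n) 0 := by
  induction n with
  | zero => exact IsDiagram.nil _
  | succ n ih =>
    exact (IsDiagram.cons 0 (2 * n) .cap _ _ (ih.cast (by simp [Piece.outs]) rfl)).cast
      (by simp [Piece.ins]; omega) rfl

theorem isDiagram_handleCompWord (side : Bool) (n : ℕ) {T T' : Word}
    (hT : IsDiagram (2 * n) T 0) (hT' : IsDiagram (2 * n) T' 0) :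
    IsDiagram (2 * n) (handleCompWord side n T T') 0 := by
  have h1 := isDiagram_insertCups 2 1 n (by omega)
  have h2 := isDiagram_unshuffle side 2 2 n
  refine (((h1.cast (by omega) rfl).append h2).append ?_).append hT'
  exact (hT.addRight (2 * n)).cast (by omega) (by omega)

theorem isDiagram_bendWord (side : Bool) (n : ℕ) {S : Word} (hS : IsDiagram n S n) :
    IsDiagram (2 * n) (bendWord side n S) 0 := by
  have h1 := (isDiagram_unshuffle side 1 1 n).cast (a' := 2 * n) (b' := n + n) (by omega) (by omega)
  exact ((h1.append (hS.shift n)).append h1.flip).append (isDiagram_caps n)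

theorem isDiagram_unbendWord (side : Bool) (n : ℕ) {T : Word} (hT : IsDiagram (2 * n) T 0) :
    IsDiagram n (unbendWord side n T) n := by
  have h1 := isDiagram_insertCups 1 0 n (by omega)
  have h2 := isDiagram_unshuffle side 1 2 n
  refine ((h1.cast (by omega) rfl).append h2).append ?_
  exact (hT.shift n).cast (by omega) rfl

theorem Move.shift {x y : Word} (h : Move x y) (s : ℕ) : Move (shift s x) (shift s y) := by
  cases h with
  | exchange i d p q =>
    simpa [RibbonTangle.shift, Nat.add_assoc] using Move.exchange (s + i) d p q
  | zigzag_left i => exact Move.zigzag_left (s + i)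
  | zigzag_right i => exact Move.zigzag_right (s + i)
  | slide_cap i b => exact Move.slide_cap (s + i) b
  | slide_cup i b => exact Move.slide_cup (s + i) b
  | reidemeister_one i b => exact Move.reidemeister_one (s + i) b
  | reidemeister_two i b => exact Move.reidemeister_two (s + i) b
  | reidemeister_three i b => exact Move.reidemeister_three (s + i) b

theorem step_context {m n m' n' : ℕ} {D E : Diagram m n} (h : Step D E) (a c : Word)
    {D' E' : Diagram m' n'} (hD : D'.1 = a ++ D.1 ++ c) (hE : E'.1 = a ++ E.1 ++ c) :
    Step D' E' := by
  obtain ⟨u, x, y, v, hm, h1, h2⟩ := h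
  exact ⟨a ++ u, x, y, v ++ c, hm, by simp [hD, h1], by simp [hE, h2]⟩

theorem step_shift {m n m' n' : ℕ} {D E : Diagram m n} (h : Step D E) (s : ℕ)
    {D' E' : Diagram m' n'} (hD : D'.1 = shift s D.1) (hE : E'.1 = shift s E.1) :
    Step D' E' := by
  obtain ⟨u, x, y, v, hm, h1, h2⟩ := h
  exact ⟨shift s u, shift s x, shift s y, shift s v, hm.shift s, by simp [hD, h1, shift],
    by simp [hE, h2, shift]⟩

namespace Tangle

/-- The trivial tangle: `n` vertical strands. -/
def id (n : ℕ) : Tangle n n := Quot.mk _ ⟨[], IsDiagram.nil n⟩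

/-- Composition `T' ∘ T`: stack `T'` on the top of `T`. -/
def comp {a b c : ℕ} (T' : Tangle b c) (T : Tangle a b) : Tangle a c :=
  Quot.map₂ (fun (E : Diagram b c) (D : Diagram a b) =>
      (⟨D.1 ++ E.1, D.2.append E.2⟩ : Diagram a c))
    (fun E _ _ h => step_context h [] E.1 (by simp) (by simp))
    (fun _ _ D h => step_context h D.1 [] (by simp) (by simp)) T' T

/-- Juxtaposition: `T` is placed on the left of `T'`. -/
def tensor {m n m' n' M N : ℕ} (hM : m + m' = M) (hN : n + n' = N) (T : Tangle m n)
    (T' : Tangle m' n') : Tangle M N :=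
  Quot.map₂ (fun (D : Diagram m n) (E : Diagram m' n') =>
      (⟨D.1 ++ shift n E.1, ((D.2.addRight m').append (E.2.shift n)).cast hM hN⟩ : Diagram M N))
    (fun D E E' h => step_context
      (step_shift h n (D' := ⟨shift n E.1, E.2.shift n⟩) (E' := ⟨shift n E'.1, E'.2.shift n⟩)
        rfl rfl) D.1 [] (by simp) (by simp))
    (fun _ _ E h => step_context h [] (shift n E.1) (by simp) (by simp)) T T'

/-- Composition of handles, see `handleCompWord`. -/
def handleComp (side : Bool) {n : ℕ} (T T' : Tangle (2 * n) 0) : Tangle (2 * n) 0 :=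
  Quot.map₂ (fun (D E : Diagram (2 * n) 0) =>
      (⟨handleCompWord side n D.1 E.1, isDiagram_handleCompWord side n D.2 E.2⟩ :
        Diagram (2 * n) 0))
    (fun D _ _ h => step_context h (insertCups 2 1 n ++ unshuffle side 2 2 n ++ D.1) []
      (by simp [handleCompWord]) (by simp [handleCompWord]))
    (fun _ _ E h => step_context h (insertCups 2 1 n ++ unshuffle side 2 2 n) E.1
      (by simp [handleCompWord]) (by simp [handleCompWord])) T T'

/-- Bending the top ends down, see `bendWord`. -/
def bend (side : Bool) {n : ℕ} (S : Tangle n n) : Tangle (2 * n) 0 :=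
  Quot.map (fun D : Diagram n n =>
      (⟨bendWord side n D.1, isDiagram_bendWord side n D.2⟩ : Diagram (2 * n) 0))
    (fun D E h => step_context
      (step_shift h n (D' := ⟨shift n D.1, D.2.shift n⟩) (E' := ⟨shift n E.1, E.2.shift n⟩)
        rfl rfl) (unshuffle side 1 1 n) (flip (unshuffle side 1 1 n) ++ caps n)
      (by simp [bendWord]) (by simp [bendWord])) S

/-- Bending every other bottom end up, see `unbendWord`. -/
def unbend (side : Bool) {n : ℕ} (T : Tangle (2 * n) 0) : Tangle n n :=
  Quot.map (fun D : Diagram (2 * n) 0 =>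
      (⟨unbendWord side n D.1, isDiagram_unbendWord side n D.2⟩ : Diagram n n))
    (fun D E h => step_context
      (step_shift h n (D' := ⟨shift n D.1, D.2.shift n⟩) (E' := ⟨shift n E.1, E.2.shift n⟩)
        rfl rfl) (insertCups 1 0 n ++ unshuffle side 1 2 n) []
      (by simp [unbendWord]) (by simp [unbendWord])) T

end Tangle

/-! ### The operations preserve string links and handles -/

theorem Conn.refl (w : Word) (P : ℕ × ℕ) : Conn w P P := Relation.EqvGen.refl P

theorem Conn.symm {w : Word} {P Q : ℕ × ℕ} (h : Conn w P Q) : Conn w Q P :=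
  Relation.EqvGen.symm _ _ h

theorem Conn.trans {w : Word} {P Q R : ℕ × ℕ} (h : Conn w P Q) (h' : Conn w Q R) : Conn w P R :=
  Relation.EqvGen.trans _ _ _ h h'

theorem Adj.conn {w : Word} {P Q : ℕ × ℕ} (h : Adj w P Q) : Conn w P Q :=
  Relation.EqvGen.rel _ _ h

theorem Conn.map {w w' : Word} (f : ℕ × ℕ → ℕ × ℕ)
    (hf : ∀ P Q, Adj w P Q → Conn w' (f P) (f Q)) {P Q : ℕ × ℕ} (h : Conn w P Q) :
    Conn w' (f P) (f Q) := by
  induction h with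
  | rel _ _ h => exact hf _ _ h
  | refl _ => exact Conn.refl _ _
  | symm _ _ _ ih => exact ih.symm
  | trans _ _ _ _ _ ih ih' => exact ih.trans ih'

theorem Adj.mono {w w' : Word} (s t : ℕ) (hw : ∀ (l i : ℕ) (p : Piece),
    w[l]? = some ⟨i, p⟩ → w'[s + l]? = some ⟨t + i, p⟩)
    {P Q : ℕ × ℕ} (h : Adj w P Q) : Conn w' (s + P.1, t + P.2) (s + Q.1, t + Q.2) := by
  cases h with
  | left h hq => exact (Adj.left (hw _ _ _ h) (by omega)).conn
  | right r h =>
    have := (Adj.right r (hw _ _ _ h)).conn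
    simpa only [Nat.add_assoc] using this
  | cup h => exact (Adj.cup (hw _ _ _ h)).conn
  | cap h => exact (Adj.cap (hw _ _ _ h)).conn
  | cross_right h => exact (Adj.cross_right (hw _ _ _ h)).conn
  | cross_left h => exact (Adj.cross_left (hw _ _ _ h)).conn

theorem Conn.append_left {u : Word} {P Q : ℕ × ℕ} (h : Conn u P Q) (v : Word) :
    Conn (u ++ v) P Q := by
  have := h.map (w' := u ++ v) (fun P => (0 + P.1, 0 + P.2)) (fun P Q hPQ =>
    hPQ.mono 0 0 (fun l i p hl => by
      have := (List.getElem?_eq_some_iff.1 hl).1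
      rw [Nat.zero_add, List.getElem?_append_left this, hl, Nat.zero_add]))
  simpa using this

theorem Conn.append_right {v : Word} {P Q : ℕ × ℕ} (h : Conn v P Q) (u : Word) :
    Conn (u ++ v) (u.length + P.1, P.2) (u.length + Q.1, Q.2) := by
  have := h.map (w' := u ++ v) (fun P => (u.length + P.1, 0 + P.2)) (fun P Q hPQ =>
    hPQ.mono u.length 0 (fun l i p hl => by
      rw [List.getElem?_append_right (by omega), Nat.add_sub_cancel_left, hl, Nat.zero_add]))
  simpa using this

theorem Conn.shift {v : Word} {P Q : ℕ × ℕ} (h : Conn v P Q) (s : ℕ) :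
    Conn (shift s v) (P.1, s + P.2) (Q.1, s + Q.2) := by
  have := h.map (w' := RibbonTangle.shift s v) (fun P => (0 + P.1, s + P.2)) (fun P Q hPQ =>
    hPQ.mono 0 s (fun l i p hl => by simp [RibbonTangle.shift, hl]))
  simpa using this

theorem length_shift (s : ℕ) (w : Word) : (shift s w).length = w.length := by simp [shift]

theorem length_flip (w : Word) : (flip w).length = w.length := by simp [flip]

/-- From the bottom to the top. -/
theorem Conn.comp {u v : Word} {p q r : ℕ} (h : Conn u (0, p) (u.length, q))
    (h' : Conn v (0, q) (v.length, r)) : Conn (u ++ v) (0, p) ((u ++ v).length, r) := by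
  have := h'.append_right u
  rw [List.length_append]
  exact (h.append_left v).trans this

theorem conn_cons {x : Layer} {v : Word} {P Q : ℕ × ℕ} (h : Conn v P Q) :
    Conn (x :: v) (P.1 + 1, P.2) (Q.1 + 1, Q.2) := by
  have := h.append_right [x]
  simpa [Nat.add_comm] using this

theorem conn_shift_left (s : ℕ) (w : Word) {q : ℕ} (hq : q < s) {l : ℕ} (hl : l ≤ w.length) :
    Conn (shift s w) (0, q) (l, q) := by
  induction l with
  | zero => exact Conn.refl _ _
  | succ l ih =>
    refine (ih (by omega)).trans (Adj.left (i := s + (w[l]'(by omega)).pos)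
      (p := (w[l]'(by omega)).piece) ?_ (by omega)).conn
    have : l < w.length := by omega
    simp [shift, this]

theorem IsDiagram.conn_right {m n : ℕ} {w : Word} (h : IsDiagram m w n) (r : ℕ) :
    Conn w (0, m + r) (w.length, n + r) := by
  induction h with
  | nil n => exact Conn.refl _ _
  | cons a b p w n _ ih =>
    have h1 : Adj (⟨a, p⟩ :: w) (0, a + p.ins + (b + r)) (0 + 1, a + p.outs + (b + r)) :=
      Adj.right (b + r) rfl
    have h2 := conn_cons (x := ⟨a, p⟩) ih
    simp only [Nat.add_assoc] at h1 h2 ⊢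
    exact h1.conn.trans h2

/-! Points. -/

theorem IsDiagram.of_append {m n : ℕ} {u v : Word} (h : IsDiagram m (u ++ v) n) :
    ∃ k, IsDiagram m u k ∧ IsDiagram k v n := by
  induction u generalizing m with
  | nil => exact ⟨m, IsDiagram.nil _, h⟩
  | cons x u ih =>
    cases h with
    | cons l r p w n h =>
      obtain ⟨k, h1, h2⟩ := ih h
      exact ⟨k, IsDiagram.cons _ _ _ _ _ h1, h2⟩

theorem IsDiagram.unique {m n n' : ℕ} {w : Word} (h : IsDiagram m w n) (h' : IsDiagram m w n') :
    n = n' := by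
  induction h generalizing n' with
  | nil n => cases h'; rfl
  | cons l r p w n _ ih =>
    generalize hm : l + p.ins + r = m at h'
    cases h' with
    | cons _ r' _ _ _ h' =>
      have : r = r' := by omega
      subst this
      exact ih h'

theorem IsPoint.append {m k : ℕ} {u v : Word} (hu : IsDiagram m u k) {P : ℕ × ℕ}
    (hP : IsPoint m (u ++ v) P) :
    IsPoint m u P ∨ ∃ Q, IsPoint k v Q ∧ P = (u.length + Q.1, Q.2) := by
  obtain ⟨h1, j, h2, h3⟩ := hP
  by_cases hl : P.1 ≤ u.length
  · left
    refine ⟨hl, j, ?_, h3⟩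
    rwa [List.take_append_of_le_length hl] at h2
  · right
    refine ⟨(P.1 - u.length, P.2), ⟨?_, j, ?_, h3⟩, ?_⟩
    · simp at h1 ⊢; omega
    · rw [List.take_append, List.take_of_length_le (by omega)] at h2
      obtain ⟨k', h4, h5⟩ := h2.of_append
      rw [hu.unique h4]; exact h5
    · ext <;> simp; omega

/-- Every point is joined to the bottom line. -/
def Down (m : ℕ) (w : Word) : Prop := ∀ P, IsPoint m w P → ∃ j < m, Conn w P (0, j)

/-- Every point is joined to the top line. -/
def Up (m n : ℕ) (w : Word) : Prop := ∀ P, IsPoint m w P → ∃ j < n, Conn w P (w.length, j)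

theorem Down.append {m k : ℕ} {u v : Word} (hu : IsDiagram m u k) (h : Down m u) (h' : Down k v) :
    Down m (u ++ v) := by
  have key : ∀ P, IsPoint m u P → ∃ j < m, Conn (u ++ v) P (0, j) := fun P hP => by
    obtain ⟨j, hj, hc⟩ := h P hP
    exact ⟨j, hj, hc.append_left v⟩
  intro P hP
  rcases hP.append hu with hP | ⟨Q, hQ, rfl⟩
  · exact key P hP
  · obtain ⟨i, hi, hc⟩ := h' Q hQ
    obtain ⟨j, hj, hc'⟩ := key (u.length, i) ⟨le_rfl, k, by simpa using hu, hi⟩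
    exact ⟨j, hj, (hc.append_right u).trans hc'⟩

theorem Up.append_down {m k : ℕ} {u v : Word} (hu : IsDiagram m u k) (h : Up m k u)
    (h' : Down k v) {P : ℕ × ℕ} (hP : IsPoint m (u ++ v) P) :
    ∃ j < k, Conn (u ++ v) P (u.length, j) := by
  rcases hP.append hu with hP | ⟨Q, hQ, rfl⟩
  · obtain ⟨j, hj, hc⟩ := h P hP
    exact ⟨j, hj, hc.append_left v⟩
  · obtain ⟨i, hi, hc⟩ := h' Q hQ
    exact ⟨i, hi, hc.append_right u⟩

theorem Up.append {m k n : ℕ} {u v : Word} (hu : IsDiagram m u k) 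
    (h : Up m k u) (h' : Up k n v) : Up m n (u ++ v) := by
  have key : ∀ Q, IsPoint k v Q →
      ∃ j < n, Conn (u ++ v) (u.length + Q.1, Q.2) ((u ++ v).length, j) := fun Q hQ => by
    obtain ⟨j, hj, hc⟩ := h' Q hQ
    refine ⟨j, hj, ?_⟩
    rw [List.length_append]
    exact hc.append_right u
  intro P hP
  rcases hP.append hu with hP | ⟨Q, hQ, rfl⟩
  · obtain ⟨i, hi, hc⟩ := h P hP
    obtain ⟨j, hj, hc'⟩ := key (0, i) ⟨by simp, k, by simpa using IsDiagram.nil k, hi⟩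
    exact ⟨j, hj, (hc.append_left v).trans hc'⟩
  · exact key Q hQ

theorem IsPoint.cons {l r : ℕ} {p : Piece} {w : Word} {P : ℕ × ℕ}
    (hP : IsPoint (l + p.ins + r) (⟨l, p⟩ :: w) P) :
    (∃ q < l + p.ins + r, P = (0, q)) ∨
      ∃ Q, IsPoint (l + p.outs + r) w Q ∧ P = (Q.1 + 1, Q.2) := by
  obtain ⟨a, q⟩ := P
  obtain ⟨h1, k, h2, h3⟩ := hP
  cases a with
  | zero =>
    left
    refine ⟨q, ?_, rfl⟩
    have := h2.unique (IsDiagram.nil _)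
    simp at h3; omega
  | succ a =>
    right
    refine ⟨(a, q), ⟨by simpa using h1, k, ?_, h3⟩, rfl⟩
    simp only [List.take_succ_cons] at h2
    generalize hm : l + p.ins + r = m at h2
    cases h2 with
    | cons _ r' _ _ _ h' =>
      have : r = r' := by omega
      subst this
      exact h'

theorem down_of_no_cup {m n : ℕ} {w : Word} (h : IsDiagram m w n)
    (hw : ∀ x ∈ w, x.piece ≠ .cup) : Down m w := by
  induction h with
  | nil n =>
    rintro ⟨a, q⟩ ⟨h1, k, h2, h3⟩
    simp only [List.length_nil, Nat.le_zero] at h1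
    subst h1
    have := h2.unique (IsDiagram.nil _)
    exact ⟨q, by simp at h3; omega, Conn.refl _ _⟩
  | cons l r p w n _ ih =>
    have ih := ih (fun x hx => hw x (List.mem_cons_of_mem _ hx))
    have hp := hw _ List.mem_cons_self
    intro P hP
    rcases hP.cons with ⟨q, hq, rfl⟩ | ⟨Q, hQ, rfl⟩
    · exact ⟨q, hq, Conn.refl _ _⟩
    · obtain ⟨j, hj, hc⟩ := ih Q hQ
      have hc := conn_cons (x := ⟨l, p⟩) hc
      suffices hs : ∃ i < l + p.ins + r, Conn (⟨l, p⟩ :: w) (0, i) (0 + 1, j) by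
        obtain ⟨i, hi, hc'⟩ := hs
        exact ⟨i, hi, hc.trans hc'.symm⟩
      by_cases h1 : j < l
      · exact ⟨j, by omega, (Adj.left rfl h1).conn⟩
      by_cases h2 : l + p.outs ≤ j
      · obtain ⟨d, rfl⟩ := Nat.exists_eq_add_of_le h2
        exact ⟨l + p.ins + d, by omega, (Adj.right d rfl).conn⟩
      cases p with
      | cup => exact absurd rfl hp
      | cap => simp only [Piece.outs] at h2; omega
      | cross b =>
        simp only [Piece.outs, Piece.ins] at *
        obtain rfl | rfl : j = l ∨ j = l + 1 := by omega
        · exact ⟨j + 1, by omega, (Adj.cross_left (w := ⟨j, .cross b⟩ :: w) rfl).conn⟩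
        · exact ⟨l, by omega, (Adj.cross_right (w := ⟨l, .cross b⟩ :: w) rfl).conn⟩

theorem up_of_no_cap {m n : ℕ} {w : Word} (h : IsDiagram m w n)
    (hw : ∀ x ∈ w, x.piece ≠ .cap) : Up m n w := by
  induction h with
  | nil n =>
    rintro ⟨a, q⟩ ⟨h1, k, h2, h3⟩
    simp only [List.length_nil, Nat.le_zero] at h1
    subst h1
    have := h2.unique (IsDiagram.nil _)
    exact ⟨q, by simp at h3; omega, Conn.refl _ _⟩
  | cons l r p w n _ ih =>
    have ih := ih (fun x hx => hw x (List.mem_cons_of_mem _ hx))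
    have hp := hw _ List.mem_cons_self
    have key : ∀ Q, IsPoint (l + p.outs + r) w Q →
        ∃ j < n, Conn (⟨l, p⟩ :: w) (Q.1 + 1, Q.2) ((⟨l, p⟩ :: w : Word).length, j) := by
      intro Q hQ
      obtain ⟨j, hj, hc⟩ := ih Q hQ
      exact ⟨j, hj, by simpa using conn_cons (x := ⟨l, p⟩) hc⟩
    intro P hP
    rcases hP.cons with ⟨j, hj, rfl⟩ | ⟨Q, hQ, rfl⟩
    · suffices hs : ∃ i < l + p.outs + r, Conn (⟨l, p⟩ :: w) (0, j) (0 + 1, i) by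
        obtain ⟨i, hi, hc'⟩ := hs
        obtain ⟨k, hk, hc⟩ := key (0, i) ⟨by simp, _, by simpa using IsDiagram.nil _, hi⟩
        exact ⟨k, hk, hc'.trans hc⟩
      by_cases h1 : j < l
      · exact ⟨j, by omega, (Adj.left rfl h1).conn⟩
      by_cases h2 : l + p.ins ≤ j
      · obtain ⟨d, rfl⟩ := Nat.exists_eq_add_of_le h2
        exact ⟨l + p.outs + d, by omega, (Adj.right d rfl).conn⟩
      cases p with
      | cap => exact absurd rfl hp
      | cup => simp only [Piece.ins] at h2; omega
      | cross b =>
        simp only [Piece.outs, Piece.ins] at *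
        obtain rfl | rfl : j = l ∨ j = l + 1 := by omega
        · exact ⟨j + 1, by omega, (Adj.cross_right (w := ⟨j, .cross b⟩ :: w) rfl).conn⟩
        · exact ⟨l, by omega, (Adj.cross_left (w := ⟨l, .cross b⟩ :: w) rfl).conn⟩
    · exact key Q hQ

theorem IsDiagram.of_shift {s m k : ℕ} {v : Word}
    (h : IsDiagram (s + m) (RibbonTangle.shift s v) k) :
    ∃ k', IsDiagram m v k' ∧ k = s + k' := by
  induction v generalizing m with
  | nil => exact ⟨m, IsDiagram.nil _, h.unique (IsDiagram.nil _)⟩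
  | cons x v ih =>
    obtain ⟨i, p⟩ := x
    have h : IsDiagram (s + m) (⟨s + i, p⟩ :: RibbonTangle.shift s v) k := h
    generalize hm : s + m = M at h
    cases h with
    | cons _ r _ _ _ h =>
      obtain ⟨k', h4, h5⟩ := ih (m := i + p.outs + r) (by
        simpa only [Nat.add_assoc] using h)
      refine ⟨k', ?_, h5⟩
      obtain rfl : m = i + p.ins + r := by omega
      exact IsDiagram.cons _ _ _ _ _ h4

theorem Down.shift {m : ℕ} {w : Word} (h : Down m w) (s : ℕ) : Down (s + m) (shift s w) := by
  rintro ⟨a, q⟩ ⟨h1, k, h2, h3⟩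
  rw [length_shift] at h1
  by_cases hq : q < s
  · exact ⟨q, by omega, (conn_shift_left s w hq h1).symm⟩
  · obtain ⟨d, rfl⟩ := Nat.exists_eq_add_of_le (Nat.le_of_not_lt hq)
    have hk : ∃ k', IsDiagram m (w.take a) k' ∧ k = s + k' := by
      refine IsDiagram.of_shift (s := s) ?_
      simpa [RibbonTangle.shift, List.map_take] using h2
    obtain ⟨k', h4, rfl⟩ := hk
    obtain ⟨j, hj, hc⟩ := h (a, d) ⟨h1, k', h4, by simpa using h3⟩
    exact ⟨s + j, by omega, hc.shift s⟩

theorem Down.addRight {m n : ℕ} {w : Word} (hw : IsDiagram m w n) (h : Down m w) (r : ℕ) :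
    Down (m + r) w := by
  rintro ⟨a, q⟩ ⟨h1, k, h2, h3⟩
  rw [← List.take_append_drop a w] at hw
  obtain ⟨k', h4, h5⟩ := hw.of_append
  have hk := h2.unique (h4.addRight r)
  subst hk
  by_cases hq : q < k'
  · obtain ⟨j, hj, hc⟩ := h (a, q) ⟨h1, k', h4, hq⟩
    exact ⟨j, by omega, hc⟩
  · obtain ⟨d, rfl⟩ := Nat.exists_eq_add_of_le (Nat.le_of_not_lt hq)
    refine ⟨m + d, by simp at h3; omega, ?_⟩
    have := (h4.conn_right d).append_left (w.drop a)
    rw [List.take_append_drop, List.length_take, Nat.min_eq_left h1] at this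
    exact this.symm

/-! Braids. -/

theorem Conn.flip_of_braid {w : Word} (hw : ∀ x ∈ w, ∃ b, x.piece = .cross b) {p q : ℕ}
    (h : Conn w (0, p) (w.length, q)) : Conn (flip w) (0, q) (w.length, p) := by
  have := h.map (w' := flip w) (fun P => (w.length - P.1, P.2)) (fun P Q hPQ => by
    have key : ∀ l i p, w[l]? = some ⟨i, p⟩ → (flip w)[w.length - (l + 1)]? = some ⟨i, p.flip⟩ ∧
        w.length - l = w.length - (l + 1) + 1 ∧ ∃ b, p = .cross b := by
      intro l i p hl
      obtain ⟨h1, h2⟩ := List.getElem?_eq_some_iff.1 hl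
      have h3 := hw _ (List.getElem_mem h1)
      rw [h2] at h3
      refine ⟨?_, by omega, h3⟩
      rw [flip, List.getElem?_reverse (by simp; omega)]
      have : w.length - 1 - (w.length - (l + 1)) = l := by omega
      simp [this, hl]
    cases hPQ with
    | left h hq =>
      obtain ⟨h1, h2, b, rfl⟩ := key _ _ _ h
      simp only [h2]
      exact (Adj.left h1 hq).conn.symm
    | right r h =>
      obtain ⟨h1, h2, b, rfl⟩ := key _ _ _ h
      simp only [h2]
      exact (Adj.right r h1).conn.symm
    | cup h => obtain ⟨h1, h2, b, h3⟩ := key _ _ _ h; cases h3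
    | cap h => obtain ⟨h1, h2, b, h3⟩ := key _ _ _ h; cases h3
    | cross_right h =>
      obtain ⟨h1, h2, b, -⟩ := key _ _ _ h
      simp only [h2]
      exact (Adj.cross_left h1).conn.symm
    | cross_left h =>
      obtain ⟨h1, h2, b, -⟩ := key _ _ _ h
      simp only [h2]
      exact (Adj.cross_right h1).conn.symm)
  simpa using this.symm

theorem strandLeft_cross (side : Bool) (i x : ℕ) :
    ∀ y ∈ strandLeft side i x, ∃ b, y.piece = .cross b := by
  induction x with
  | zero => simp [strandLeft]
  | succ x ih => simpa [strandLeft] using ih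

theorem block_cross (side : Bool) (i x y : ℕ) :
    ∀ z ∈ block side i x y, ∃ b, z.piece = .cross b := by
  induction y with
  | zero => simp [block]
  | succ y ih =>
    intro z hz
    rw [block, List.mem_append] at hz
    exact hz.elim (ih z) (strandLeft_cross _ _ _ z)

theorem unshuffle_cross (side : Bool) (p q n : ℕ) :
    ∀ z ∈ unshuffle side p q n, ∃ b, z.piece = .cross b := by
  induction n with
  | zero => simp [unshuffle]
  | succ n ih =>
    intro z hz
    rw [unshuffle, List.mem_append] at hz
    exact hz.elim (ih z) (block_cross _ _ _ _ z)

theorem flip_cross {w : Word} (h : ∀ z ∈ w, ∃ b, z.piece = .cross b) :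
    ∀ z ∈ flip w, ∃ b, z.piece = .cross b := by
  intro z hz
  simp only [flip, List.mem_reverse, List.mem_map] at hz
  obtain ⟨x, hx, rfl⟩ := hz
  obtain ⟨b, hb⟩ := h x hx
  exact ⟨!b, by simp [hb, Piece.flip]⟩

theorem down_of_cross {m n : ℕ} {w : Word} (h : IsDiagram m w n)
    (hw : ∀ z ∈ w, ∃ b, z.piece = .cross b) : Down m w :=
  down_of_no_cup h fun x hx => by obtain ⟨b, hb⟩ := hw x hx; simp [hb]

theorem up_of_cross {m n : ℕ} {w : Word} (h : IsDiagram m w n)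
    (hw : ∀ z ∈ w, ∃ b, z.piece = .cross b) : Up m n w :=
  up_of_no_cap h fun x hx => by obtain ⟨b, hb⟩ := hw x hx; simp [hb]

theorem strandLeft_left (side : Bool) (i x : ℕ) {q : ℕ} (hq : q < i) :
    Conn (strandLeft side i x) (0, q) ((strandLeft side i x).length, q) := by
  induction x with
  | zero => exact Conn.refl _ _
  | succ x ih =>
    have h : Adj (strandLeft side i (x + 1)) (0, q) (0 + 1, q) := Adj.left rfl (by omega)
    exact h.conn.trans (conn_cons ih)

theorem strandLeft_mover (side : Bool) (i x : ℕ) :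
    Conn (strandLeft side i x) (0, i + x) ((strandLeft side i x).length, i) := by
  induction x with
  | zero => exact Conn.refl _ _
  | succ x ih =>
    have h : Adj (strandLeft side i (x + 1)) (0, i + x + 1) (0 + 1, i + x) :=
      Adj.cross_left (b := side) rfl
    exact h.conn.trans (conn_cons ih)

theorem strandLeft_right (side : Bool) (i x r : ℕ) :
    Conn (strandLeft side i x) (0, i + x + 1 + r) ((strandLeft side i x).length, i + x + 1 + r) :=
  (isDiagram_strandLeft side i x).conn_right r

theorem strandLeft_mid (side : Bool) (i x : ℕ) {t : ℕ} (ht : t < x) :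
    Conn (strandLeft side i x) (0, i + t) ((strandLeft side i x).length, i + t + 1) := by
  induction x with
  | zero => omega
  | succ x ih =>
    by_cases h : t < x
    · have h' : Adj (strandLeft side i (x + 1)) (0, i + t) (0 + 1, i + t) :=
        Adj.left rfl (by omega)
      exact h'.conn.trans (conn_cons (ih h))
    · obtain rfl : t = x := by omega
      have h' : Adj (strandLeft side i (t + 1)) (0, i + t) (0 + 1, i + t + 1) :=
        Adj.cross_right (b := side) rfl
      exact h'.conn.trans (conn_cons (strandLeft_right side i t 0))

theorem block_left (side : Bool) (i x y : ℕ) {q : ℕ} (hq : q < i) :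
    Conn (block side i x y) (0, q) ((block side i x y).length, q) := by
  induction y with
  | zero => exact Conn.refl _ _
  | succ y ih => exact ih.comp (strandLeft_left side (i + y) x (by omega))

theorem block_right (side : Bool) (i x y r : ℕ) :
    Conn (block side i x y) (0, i + x + y + r) ((block side i x y).length, i + x + y + r) :=
  (isDiagram_block side i x y).conn_right r

theorem block_mid (side : Bool) (i x y : ℕ) {t : ℕ} (ht : t < x) :
    Conn (block side i x y) (0, i + t) ((block side i x y).length, i + y + t) := by
  induction y with
  | zero => exact Conn.refl _ _
  | succ y ih =>
    have := ih.comp (strandLeft_mid side (i + y) x ht)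
    rwa [show i + y + t + 1 = i + (y + 1) + t by omega] at this

theorem block_mover (side : Bool) (i x y : ℕ) {t : ℕ} (ht : t < y) :
    Conn (block side i x y) (0, i + x + t) ((block side i x y).length, i + t) := by
  induction y with
  | zero => omega
  | succ y ih =>
    by_cases h : t < y
    · exact (ih h).comp (strandLeft_left side (i + y) x (by omega))
    · obtain rfl : t = y := by omega
      have h1 := block_right side i x t 0
      have h2 := strandLeft_mover side (i + t) x
      rw [show i + t + x = i + x + t + 0 by omega] at h2
      exact h1.comp h2

theorem unshuffle_fst (side : Bool) (p q : ℕ) {n k j : ℕ} (hk : k < n) (hj : j < p) :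
    Conn (unshuffle side p q n) (0, k * (p + q) + j)
      ((unshuffle side p q n).length, k * p + j) := by
  induction n with
  | zero => omega
  | succ n ih =>
    by_cases h : k < n
    · refine (ih h).comp (block_left side (n * p) (n * q) p ?_)
      calc k * p + j < (k + 1) * p := by rw [Nat.succ_mul]; omega
        _ ≤ n * p := Nat.mul_le_mul_right _ h
    · obtain rfl : k = n := by omega
      refine ((isDiagram_unshuffle side p q k).conn_right j).comp ?_
      have := block_mover side (k * p) (k * q) p hj
      rwa [← Nat.mul_add] at this

theorem unshuffle_snd (side : Bool) (p q : ℕ) {n k j : ℕ} (hk : k < n) (hj : j < q) :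
    Conn (unshuffle side p q n) (0, k * (p + q) + p + j)
      ((unshuffle side p q n).length, n * p + k * q + j) := by
  induction n with
  | zero => omega
  | succ n ih =>
    by_cases h : k < n
    · refine (ih h).comp ?_
      have ht : k * q + j < n * q :=
        calc k * q + j < (k + 1) * q := by rw [Nat.succ_mul]; omega
          _ ≤ n * q := Nat.mul_le_mul_right _ h
      have := block_mid side (n * p) (n * q) p ht
      rwa [← Nat.add_assoc, ← Nat.add_assoc, ← Nat.succ_mul] at this
    · obtain rfl : k = n := by omega
      have h1 := (isDiagram_unshuffle side p q k).conn_right (p + j)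
      have h2 := block_right side (k * p) (k * q) p j
      rw [← Nat.add_assoc] at h1
      rw [← Nat.mul_add] at h2
      have := h1.comp h2
      rwa [show k * (p + q) + p + j = (k + 1) * p + k * q + j by ring] at this ⊢

theorem insertCups_left {r o n k j : ℕ} (ho : o ≤ r) (hk : k < n) (hj : j < o) :
    Conn (insertCups r o n) (0, k * r + j) ((insertCups r o n).length, k * (r + 2) + j) := by
  induction n with
  | zero => omega
  | succ n ih =>
    by_cases h : k < n
    · refine (ih h).comp (Adj.left (i := n * (r + 2) + o) (p := .cup) rfl ?_).conn
      have : (k + 1) * (r + 2) ≤ n * (r + 2) := Nat.mul_le_mul_right _ h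
      rw [Nat.succ_mul] at this
      omega
    · obtain rfl : k = n := by omega
      exact ((isDiagram_insertCups r o k ho).conn_right j).comp
        (Adj.left (i := k * (r + 2) + o) (p := .cup) rfl (by omega)).conn

theorem insertCups_right {r o n k j : ℕ} (hk : k < n) (hj : o + j < r) :
    Conn (insertCups r o n) (0, k * r + o + j)
      ((insertCups r o n).length, k * (r + 2) + o + 2 + j) := by
  induction n with
  | zero => omega
  | succ n ih =>
    by_cases h : k < n
    · refine (ih h).comp (Adj.left (i := n * (r + 2) + o) (p := .cup) rfl ?_).conn
      have : (k + 1) * (r + 2) ≤ n * (r + 2) := Nat.mul_le_mul_right _ h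
      rw [Nat.succ_mul] at this
      omega
    · obtain rfl : k = n := by omega
      have h1 := (isDiagram_insertCups r o k (by omega)).conn_right (o + j)
      rw [← Nat.add_assoc, ← Nat.add_assoc] at h1
      exact h1.comp (Adj.right (i := k * (r + 2) + o) (p := .cup) j rfl).conn

theorem insertCups_cup {r o n k : ℕ} (ho : o ≤ r) (hk : k < n) :
    Conn (insertCups r o n) ((insertCups r o n).length, k * (r + 2) + o)
      ((insertCups r o n).length, k * (r + 2) + o + 1) := by
  induction n with
  | zero => omega
  | succ n ih =>
    rw [insertCups, List.length_append]
    by_cases h : k < n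
    · have : (k + 1) * (r + 2) ≤ n * (r + 2) := Nat.mul_le_mul_right _ h
      rw [Nat.succ_mul] at this
      have h1 : ∀ q < n * (r + 2) + o, Conn [⟨n * (r + 2) + o, .cup⟩] (0, q) (1, q) := fun q hq =>
        (Adj.left (i := n * (r + 2) + o) (p := .cup) rfl hq).conn
      have h2 := (h1 (k * (r + 2) + o) (by omega)).append_right (insertCups r o n)
      have h3 := (h1 (k * (r + 2) + o + 1) (by omega)).append_right (insertCups r o n)
      exact h2.symm.trans (((ih h).append_left _).trans h3)
    · obtain rfl : k = n := by omega
      have h1 : Adj [⟨k * (r + 2) + o, .cup⟩] (0 + 1, k * (r + 2) + o)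
        (0 + 1, k * (r + 2) + o + 1) := Adj.cup rfl
      exact h1.conn.append_right (insertCups r o k)

theorem insertCups_no_cap (r o n : ℕ) : ∀ x ∈ insertCups r o n, x.piece ≠ .cap := by
  induction n with
  | zero => simp [insertCups]
  | succ n ih =>
    intro x hx
    rw [insertCups, List.mem_append] at hx
    rcases hx with hx | hx
    · exact ih x hx
    · simp at hx; simp [hx]

theorem conn_caps {n k : ℕ} (hk : k < n) : Conn (caps n) (0, 2 * k) (0, 2 * k + 1) := by
  induction n generalizing k with
  | zero => omega
  | succ n ih =>
    have hc : caps (n + 1) = ⟨0, .cap⟩ :: caps n := rfl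
    rw [hc]
    cases k with
    | zero => exact (Adj.cap rfl).conn
    | succ k =>
      have h1 := conn_cons (x := ⟨0, .cap⟩) (ih (k := k) (by omega))
      have h2 : ∀ q, Conn (⟨0, .cap⟩ :: caps n) (0, q + 2) (0 + 1, q) := fun q => by
        have := (Adj.right (w := ⟨0, .cap⟩ :: caps n) (l := 0) (i := 0) (p := .cap) q rfl).conn
        simpa [Piece.ins, Piece.outs, Nat.add_comm] using this
      have h3 := h2 (2 * k)
      have h4 := h2 (2 * k + 1)
      exact (h3.trans h1).trans h4.symm

/-! The operations. -/

theorem isStringLink_nil (n : ℕ) : IsStringLink n [] :=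
  ⟨IsDiagram.nil n, fun _ _ => Conn.refl _ _, down_of_no_cup (IsDiagram.nil n) (by simp)⟩

theorem isHandle_caps (n : ℕ) : IsHandle n (caps n) :=
  ⟨isDiagram_caps n, fun _ hk => conn_caps hk, down_of_no_cup (isDiagram_caps n) (by simp [caps])⟩

theorem IsStringLink.append {n : ℕ} {D E : Word} (hD : IsStringLink n D) (hE : IsStringLink n E) :
    IsStringLink n (D ++ E) :=
  ⟨hD.1.append hE.1, fun k hk => (hD.2.1 k hk).comp (hE.2.1 k hk),
    Down.append hD.1 hD.2.2 hE.2.2⟩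

theorem IsStringLink.tensor {m n : ℕ} {D E : Word} (hD : IsStringLink m D)
    (hE : IsStringLink n E) : IsStringLink (m + n) (D ++ shift m E) := by
  refine ⟨(hD.1.addRight n).append (hE.1.shift m), fun k hk => ?_,
    Down.append (hD.1.addRight n) (Down.addRight hD.1 hD.2.2 n) (Down.shift hE.2.2 m)⟩
  by_cases h : k < m
  · refine (hD.2.1 k h).comp ?_
    have := conn_shift_left m E h le_rfl
    rwa [← length_shift m E] at this
  · obtain ⟨d, rfl⟩ := Nat.exists_eq_add_of_le (Nat.le_of_not_lt h)
    have := (hE.2.1 d (by omega)).shift m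
    rw [← length_shift m E] at this
    exact (hD.1.conn_right d).comp this

theorem IsHandle.tensor {m n : ℕ} {D E : Word} (hD : IsHandle m D)
    (hE : IsHandle n E) : IsHandle (m + n) (D ++ shift 0 E) := by
  have hs : shift 0 E = E := by simp [shift]
  have h2 : 2 * (m + n) = 2 * m + 2 * n := by omega
  have h3 := (hD.1.addRight (2 * n)).cast rfl (Nat.zero_add (2 * n))
  unfold IsHandle
  rw [hs, h2]
  refine ⟨h3.append hE.1, fun k hk => ?_,
    Down.append h3 (Down.addRight hD.1 hD.2.2 _) hE.2.2⟩
  by_cases h : k < m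
  · exact (hD.2.1 k h).append_left E
  · obtain ⟨d, rfl⟩ := Nat.exists_eq_add_of_le (Nat.le_of_not_lt h)
    have h4 := (hE.2.1 d (by omega)).append_right D
    have h5 : ∀ q, Conn (D ++ E) (0, 2 * m + q) (D.length + 0, q) := fun q => by
      have := (hD.1.conn_right q).append_left E
      rwa [Nat.zero_add] at this
    rw [show 2 * (m + d) + 1 = 2 * m + (2 * d + 1) by omega, Nat.mul_add]
    exact (h5 _).trans (h4.trans (h5 _).symm)

theorem IsStringLink.bend (side : Bool) {n : ℕ} {S : Word} (hS : IsStringLink n S) :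
    IsHandle n (bendWord side n S) := by
  set U := unshuffle side 1 1 n with hU
  have d1 : IsDiagram (2 * n) U (n + n) :=
    (isDiagram_unshuffle side 1 1 n).cast (by omega) (by omega)
  have d2 := hS.1.shift n
  have d3 := d1.flip
  have d4 := isDiagram_caps n
  have c1 := unshuffle_cross side 1 1 n
  refine ⟨isDiagram_bendWord side n hS.1, fun k hk => ?_, ?_⟩
  · have e1 : Conn U (0, 2 * k) (U.length, k) := by
      have := unshuffle_fst side 1 1 hk (j := 0) (by omega)
      simpa [Nat.mul_comm] using this
    have e2 : Conn U (0, 2 * k + 1) (U.length, n + k) := by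
      have := unshuffle_snd side 1 1 hk (j := 0) (by omega)
      simpa [Nat.mul_comm] using this
    have f1 := e1.flip_of_braid c1
    have f2 := e2.flip_of_braid c1
    rw [← length_flip] at f1 f2
    have g1 : Conn (shift n S) (0, k) ((shift n S).length, k) := by
      rw [length_shift]; exact conn_shift_left n S hk le_rfl
    have g2 : Conn (shift n S) (0, n + k) ((shift n S).length, n + k) := by
      rw [length_shift]; exact (hS.2.1 k hk).shift n
    have a1 := ((e1.comp g1).comp f1).append_left (caps n)
    have a2 := ((e2.comp g2).comp f2).append_left (caps n)
    have a3 := (conn_caps hk).append_right (U ++ shift n S ++ flip U)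
    exact a1.trans (Conn.trans a3 a2.symm)
  · exact Down.append ((d1.append d2).append d3) (Down.append (d1.append d2)
      (Down.append d1 (down_of_cross d1 c1) (Down.shift hS.2.2 n))
      (down_of_cross d3 (flip_cross c1))) (down_of_no_cup d4 (by simp [caps]))

theorem IsHandle.unbend (side : Bool) {n : ℕ} {T : Word} (hT : IsHandle n T) :
    IsStringLink n (unbendWord side n T) := by
  set C := insertCups 1 0 n with hC
  set U := unshuffle side 1 2 n with hU
  have d1 : IsDiagram n C (n * 3) :=
    (isDiagram_insertCups 1 0 n (by omega)).cast (by omega) (by omega)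
  have d2 : IsDiagram (n * 3) U (n + 2 * n) :=
    (isDiagram_unshuffle side 1 2 n).cast (by omega) (by omega)
  have d3 := hT.1.shift n
  have u1 : Up n (n + 2 * n) (C ++ U) := Up.append d1
    (up_of_no_cap d1 (insertCups_no_cap 1 0 n)) (up_of_cross d2 (unshuffle_cross side 1 2 n))
  have bot : ∀ k < n, Conn (C ++ U) (0, k) ((C ++ U).length, n + (2 * k + 1)) := fun k hk => by
    have h1 := insertCups_right (r := 1) (o := 0) (j := 0) hk (by omega)
    have h2 := unshuffle_snd side 1 2 hk (j := 1) (by omega)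
    simp only [Nat.mul_one, Nat.add_zero] at h1 h2
    rw [show n + k * 2 + 1 = n + (2 * k + 1) by omega] at h2
    exact h1.comp h2
  have cup : ∀ k < n, Conn (C ++ U) ((C ++ U).length, k) ((C ++ U).length, n + 2 * k) :=
    fun k hk => by
      have h1 := (insertCups_cup (r := 1) (o := 0) (by omega) hk).append_left U
      have h2 := (unshuffle_fst side 1 2 hk (j := 0) (by omega)).append_right C
      have h3 := (unshuffle_snd side 1 2 hk (j := 0) (by omega)).append_right C
      simp only [Nat.mul_one, Nat.add_zero] at h1 h2 h3
      rw [show n + k * 2 = n + 2 * k by omega] at h3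
      rw [List.length_append]
      exact h2.symm.trans (h1.trans h3)
  have han : ∀ k < n, Conn (C ++ U ++ shift n T) ((C ++ U).length, n + 2 * k)
      ((C ++ U).length, n + (2 * k + 1)) := fun k hk =>
    ((hT.2.1 k hk).shift n).append_right (C ++ U)
  have all : ∀ j < n + 2 * n, ∃ k < n,
      Conn (C ++ U ++ shift n T) ((C ++ U).length, j) (0, k) := by
    have base : ∀ k < n, Conn (C ++ U ++ shift n T) ((C ++ U).length, n + 2 * k) (0, k) :=
      fun k hk => (han k hk).trans ((bot k hk).append_left _).symm
    intro j hj
    by_cases h : j < n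
    · exact ⟨j, h, ((cup j h).append_left _).trans (base j h)⟩
    · obtain ⟨d, rfl⟩ := Nat.exists_eq_add_of_le (Nat.le_of_not_lt h)
      refine ⟨d / 2, by omega, ?_⟩
      rcases Nat.mod_two_eq_zero_or_one d with h2 | h2
      · have := base (d / 2) (by omega)
        rwa [show 2 * (d / 2) = d by omega] at this
      · have := ((bot (d / 2) (by omega)).append_left (shift n T)).symm
        rwa [show 2 * (d / 2) + 1 = d by omega] at this
  refine ⟨isDiagram_unbendWord side n hT.1, fun k hk => ?_, fun P hP => ?_⟩
  · have h1 := ((bot k hk).append_left (shift n T)).trans ((han k hk).symm.trans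
      ((cup k hk).append_left (shift n T)).symm)
    have h2 := (conn_shift_left n T hk le_rfl).append_right (C ++ U)
    have h3 := h1.trans h2
    rw [← length_shift n T, ← List.length_append] at h3
    exact h3
  · obtain ⟨j, hj, hc⟩ := Up.append_down (d1.append d2) u1 (Down.shift hT.2.2 n) hP
    obtain ⟨k, hk, hc'⟩ := all j hj
    exact ⟨k, hk, hc.trans hc'⟩

theorem IsHandle.comp (side : Bool) {n : ℕ} {T T' : Word} (hT : IsHandle n T)
    (hT' : IsHandle n T') : IsHandle n (handleCompWord side n T T') := by
  have hTT := hT.tensor hT'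
  rw [show shift 0 T' = T' by simp [shift]] at hTT
  set V := T ++ T' with hV
  have hw : handleCompWord side n T T' =
      insertCups 2 1 n ++ unshuffle side 2 2 n ++ V := by simp [handleCompWord, hV]
  set C := insertCups 2 1 n with hC
  set U := unshuffle side 2 2 n with hU
  have d1 : IsDiagram (2 * n) C (n * 4) :=
    (isDiagram_insertCups 2 1 n (by omega)).cast (by omega) (by omega)
  have d2 : IsDiagram (n * 4) U (2 * (n + n)) :=
    (isDiagram_unshuffle side 2 2 n).cast (by omega) (by omega)
  have u1 : Up (2 * n) (2 * (n + n)) (C ++ U) := Up.append d1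
    (up_of_no_cap d1 (insertCups_no_cap 2 1 n)) (up_of_cross d2 (unshuffle_cross side 2 2 n))
  have botL : ∀ k < n, Conn (C ++ U) (0, 2 * k) ((C ++ U).length, 2 * k) := fun k hk => by
    have h1 := insertCups_left (r := 2) (o := 1) (j := 0) (by omega) hk (by omega)
    have h2 := unshuffle_fst side 2 2 hk (j := 0) (by omega)
    simp only [Nat.add_zero, Nat.mul_comm k 2] at h1 h2
    exact h1.comp h2
  have botR : ∀ k < n, Conn (C ++ U) (0, 2 * k + 1) ((C ++ U).length, 2 * (n + k) + 1) :=
    fun k hk => by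
      have h1 := insertCups_right (r := 2) (o := 1) (j := 0) hk (by omega)
      have h2 := unshuffle_snd side 2 2 hk (j := 1) (by omega)
      rw [show n * 2 + k * 2 + 1 = 2 * (n + k) + 1 by omega] at h2
      simp only [Nat.add_zero, Nat.mul_comm k 2] at h1 h2
      exact h1.comp h2
  have cup : ∀ k < n, Conn (C ++ U) ((C ++ U).length, 2 * k + 1)
      ((C ++ U).length, 2 * (n + k)) := fun k hk => by
    have h1 := (insertCups_cup (r := 2) (o := 1) (by omega) hk).append_left U
    have h2 := (unshuffle_fst side 2 2 hk (j := 1) (by omega)).append_right C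
    have h3 := (unshuffle_snd side 2 2 hk (j := 0) (by omega)).append_right C
    rw [show k * 2 + 1 = 2 * k + 1 by omega] at h2
    rw [show n * 2 + k * 2 + 0 = 2 * (n + k) by omega] at h3
    rw [List.length_append]
    exact h2.symm.trans (h1.trans h3)
  have han : ∀ k < n + n, Conn (C ++ U ++ V) ((C ++ U).length, 2 * k)
      ((C ++ U).length, 2 * k + 1) := fun k hk => (hTT.2.1 k hk).append_right (C ++ U)
  have cL : ∀ k < n, Conn (C ++ U ++ V) ((C ++ U).length, 2 * k) (0, 2 * k) := fun k hk =>
    ((botL k hk).append_left V).symm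
  have cR : ∀ k < n, Conn (C ++ U ++ V) ((C ++ U).length, 2 * (n + k)) (0, 2 * k + 1) :=
    fun k hk => (han (n + k) (by omega)).trans ((botR k hk).append_left V).symm
  have all : ∀ i < n + n, ∃ k < 2 * n,
      Conn (C ++ U ++ V) ((C ++ U).length, 2 * i) (0, k) := fun i hi => by
    by_cases h : i < n
    · exact ⟨2 * i, by omega, cL i h⟩
    · obtain ⟨d, rfl⟩ := Nat.exists_eq_add_of_le (Nat.le_of_not_lt h)
      exact ⟨2 * d + 1, by omega, cR d (by omega)⟩
  refine ⟨isDiagram_handleCompWord side n hT.1 hT'.1, fun k hk => ?_, fun P hP => ?_⟩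
  · rw [hw]
    exact (cL k hk).symm.trans ((han k (by omega)).trans
      (((cup k hk).append_left V).trans (cR k hk)))
  · rw [hw] at hP ⊢
    obtain ⟨j, hj, hc⟩ := Up.append_down (d1.append d2) u1 hTT.2.2 hP
    obtain ⟨k, hk, hc'⟩ := all (j / 2) (by omega)
    refine ⟨k, hk, hc.trans ?_⟩
    rcases Nat.mod_two_eq_zero_or_one j with h2 | h2
    · rwa [show 2 * (j / 2) = j by omega] at hc'
    · have h3 := han (j / 2) (by omega)
      rw [show 2 * (j / 2) + 1 = j by omega] at h3
      exact h3.symm.trans hc'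

/-! ### Categories with objects the non-negative integers and only endomorphisms -/

/-- The operations of a strict monoidal category whose objects are the non-negative integers, with
`m ⊗ n = m + n`, with `Hom(n, n) = M n`, and with `Hom(m, n) = ∅` for `m ≠ n`.  Here `comp g f` is
`g ∘ f`. -/
class EndoOps (M : ℕ → Type) where
  id (n : ℕ) : M n
  comp {n : ℕ} (g f : M n) : M n
  tensor {m n : ℕ} (f : M m) (g : M n) : M (m + n)

/-- The axioms of a strict monoidal category. -/
class LawfulEndoOps (M : ℕ → Type) [EndoOps M] : Prop where
  id_comp {n : ℕ} (f : M n) : EndoOps.comp (EndoOps.id n) f = f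
  comp_id {n : ℕ} (f : M n) : EndoOps.comp f (EndoOps.id n) = f
  assoc {n : ℕ} (h g f : M n) :
    EndoOps.comp (EndoOps.comp h g) f = EndoOps.comp h (EndoOps.comp g f)
  tensor_id (m n : ℕ) : EndoOps.tensor (EndoOps.id m) (EndoOps.id n) = (EndoOps.id (m + n) : M _)
  tensor_comp {m n : ℕ} (g f : M m) (g' f' : M n) :
    EndoOps.tensor (EndoOps.comp g f) (EndoOps.comp g' f') =
      EndoOps.comp (EndoOps.tensor g g') (EndoOps.tensor f f')
  tensor_assoc {m n k : ℕ} (f : M m) (g : M n) (h : M k) :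
    HEq (EndoOps.tensor (EndoOps.tensor f g) h) (EndoOps.tensor f (EndoOps.tensor g h))
  id_tensor {n : ℕ} (f : M n) : HEq (EndoOps.tensor (EndoOps.id 0) f) f
  tensor_id_zero {n : ℕ} (f : M n) : HEq (EndoOps.tensor f (EndoOps.id 0)) f

/-- The type of objects: a copy of the non-negative integers. -/
@[ext]
structure EndoCat (M : ℕ → Type) : Type where
  n : ℕ

namespace EndoCat

variable {M N : ℕ → Type}

/-- Morphisms: the elements of `M n` from `n` to `n`, and nothing else. -/
inductive Hom (M : ℕ → Type) : EndoCat M → EndoCat M → Type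
  | of {n : ℕ} (f : M n) : Hom M ⟨n⟩ ⟨n⟩

/-- Composition in diagrammatic order: `comp f g` is `g ∘ f`. -/
def Hom.comp [EndoOps M] : {X Y Z : EndoCat M} → Hom M X Y → Hom M Y Z → Hom M X Z
  | _, _, _, .of f, .of g => .of (EndoOps.comp g f)

/-- The monoidal product of morphisms. -/
def Hom.tensor [EndoOps M] : {X Y X' Y' : EndoCat M} → Hom M X Y → Hom M X' Y' →
    Hom M ⟨X.n + X'.n⟩ ⟨Y.n + Y'.n⟩
  | _, _, _, _, .of f, .of g => .of (EndoOps.tensor f g)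

instance [EndoOps M] [LawfulEndoOps M] : Category (EndoCat M) where
  Hom := Hom M
  id X := .of (EndoOps.id X.n)
  comp := Hom.comp
  id_comp := by
    rintro _ _ ⟨f⟩
    exact congrArg Hom.of (LawfulEndoOps.comp_id f)
  comp_id := by
    rintro _ _ ⟨f⟩
    exact congrArg Hom.of (LawfulEndoOps.id_comp f)
  assoc := by
    rintro _ _ _ _ ⟨f⟩ ⟨g⟩ ⟨h⟩
    exact congrArg Hom.of (LawfulEndoOps.assoc h g f).symm

/-- A morphism `n ⟶ n` of the category. -/
def hom [EndoOps M] [LawfulEndoOps M] {n : ℕ} (f : M n) :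
    (⟨n⟩ : EndoCat M) ⟶ (⟨n⟩ : EndoCat M) := Hom.of f

theorem hom_heq [EndoOps M] [LawfulEndoOps M] {m n : ℕ} (h : m = n) {f : M m} {g : M n}
    (hfg : HEq f g) :
    hom f ≫ eqToHom (by rw [h]) = eqToHom (by rw [h]) ≫ hom g := by
  subst h
  cases hfg
  simp

instance [EndoOps M] [LawfulEndoOps M] : MonoidalCategoryStruct (EndoCat M) where
  tensorObj X Y := ⟨X.n + Y.n⟩
  tensorHom f g := Hom.tensor f g
  whiskerLeft X _ _ g := Hom.tensor (𝟙 X) g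
  whiskerRight f Y := Hom.tensor f (𝟙 Y)
  tensorUnit := ⟨0⟩
  associator X Y Z := eqToIso (EndoCat.ext (Nat.add_assoc X.n Y.n Z.n))
  leftUnitor X := eqToIso (EndoCat.ext (Nat.zero_add X.n))
  rightUnitor X := eqToIso (EndoCat.ext (Nat.add_zero X.n))

theorem eqToHom_tensor [EndoOps M] [LawfulEndoOps M] {X Y X' Y' : EndoCat M} (h : X = Y)
    (h' : X' = Y') : eqToHom h ⊗ₘ eqToHom h' = eqToHom (by rw [h, h']) := by
  subst h h'
  exact congrArg Hom.of (LawfulEndoOps.tensor_id X.n X'.n)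

instance [EndoOps M] [LawfulEndoOps M] : MonoidalCategory (EndoCat M) :=
  MonoidalCategory.ofTensorHom
    (id_tensorHom_id := fun X Y => eqToHom_tensor (rfl : X = X) (rfl : Y = Y))
    (tensorHom_comp_tensorHom := by
      rintro _ _ _ _ _ _ ⟨f⟩ ⟨g⟩ ⟨f'⟩ ⟨g'⟩
      exact congrArg Hom.of (LawfulEndoOps.tensor_comp f' f g' g).symm)
    (associator_naturality := by
      rintro _ _ _ _ _ _ ⟨f⟩ ⟨g⟩ ⟨h⟩
      exact hom_heq (Nat.add_assoc _ _ _) (LawfulEndoOps.tensor_assoc f g h))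
    (leftUnitor_naturality := by
      rintro _ _ ⟨f⟩
      exact hom_heq (Nat.zero_add _) (LawfulEndoOps.id_tensor f))
    (rightUnitor_naturality := by
      rintro _ _ ⟨f⟩
      exact hom_heq (Nat.add_zero _) (LawfulEndoOps.tensor_id_zero f))
    (pentagon := fun W X Y Z => by
      have h1 : (α_ W X Y).hom ⊗ₘ 𝟙 Z = (α_ W X Y).hom ⊗ₘ eqToHom rfl := rfl
      have h2 : 𝟙 W ⊗ₘ (α_ X Y Z).hom = eqToHom rfl ⊗ₘ (α_ X Y Z).hom := rfl
      rw [h1, h2]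
      simp only [MonoidalCategoryStruct.associator, eqToIso.hom]
      erw [eqToHom_tensor, eqToHom_tensor]
      simp)
    (triangle := fun X Y => by
      have h1 : (ρ_ X).hom ⊗ₘ 𝟙 Y = (ρ_ X).hom ⊗ₘ eqToHom rfl := rfl
      have h2 : 𝟙 X ⊗ₘ (λ_ Y).hom = eqToHom rfl ⊗ₘ (λ_ Y).hom := rfl
      rw [h1, h2]
      simp only [MonoidalCategoryStruct.associator, MonoidalCategoryStruct.leftUnitor,
        MonoidalCategoryStruct.rightUnitor, eqToIso.hom]
      erw [eqToHom_tensor, eqToHom_tensor]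
      simp)

/-- The maps `f n : M n → N n` preserve identities and composition. -/
structure IsFunctorial [EndoOps M] [EndoOps N] (f : ∀ n, M n → N n) : Prop where
  map_id (n : ℕ) : f n (EndoOps.id n) = EndoOps.id n
  map_comp {n : ℕ} (x y : M n) : f n (EndoOps.comp x y) = EndoOps.comp (f n x) (f n y)

/-- The functor which is the identity on objects, and is given by the maps `f n` on morphisms. -/
def functor [EndoOps M] [LawfulEndoOps M] [EndoOps N] [LawfulEndoOps N] (f : ∀ n, M n → N n)
    (hf : IsFunctorial f) : EndoCat M ⥤ EndoCat N where
  obj X := ⟨X.n⟩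
  map g := match g with
    | .of x => Hom.of (f _ x)
  map_id X := congrArg Hom.of (hf.map_id X.n)
  map_comp := by
    rintro _ _ _ ⟨x⟩ ⟨y⟩
    exact congrArg Hom.of (hf.map_comp y x)

end EndoCat

/-- Strict monoidal functors: the structure morphisms of the monoidal functor are identities. -/
def IsStrictMonoidal {C D : Type} [Category.{0} C] [MonoidalCategory C] [Category.{0} D]
    [MonoidalCategory D] (F : C ⥤ D) : Prop :=
  ∃ _ : F.Monoidal,
    (∃ h : 𝟙_ D = F.obj (𝟙_ C), Functor.LaxMonoidal.ε F = eqToHom h) ∧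
    ∀ X Y : C, ∃ h : F.obj X ⊗ F.obj Y = F.obj (X ⊗ Y), Functor.LaxMonoidal.μ F X Y = eqToHom h

/-! ### The categories of ribbon string links and of ribbon handles, and the functors -/

/-- The operations of the category of ribbon string links: trivial string links, stacking, and
juxtaposition. -/
instance : EndoOps RSL where
  id n := ⟨Tangle.id n, ⟨[], IsDiagram.nil n⟩, isStringLink_nil n, rfl⟩
  comp S' S := ⟨S'.1.comp S.1, by
    obtain ⟨_, D', hD', rfl⟩ := S'
    obtain ⟨_, D, hD, rfl⟩ := S
    exact ⟨⟨D.1 ++ D'.1, _⟩, hD.append hD', rfl⟩⟩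
  tensor S S' := ⟨Tangle.tensor rfl rfl S.1 S'.1, by
    obtain ⟨_, D', hD', rfl⟩ := S'
    obtain ⟨_, D, hD, rfl⟩ := S
    exact ⟨⟨D.1 ++ shift _ D'.1, _⟩, hD.tensor hD', rfl⟩⟩

/-- The operations of the category of ribbon handles: `n` caps, the composition of
`handleCompWord`, and juxtaposition. -/
instance (side : Bool) : EndoOps (RHand side) where
  id n := ⟨Quot.mk _ ⟨caps n, isDiagram_caps n⟩, ⟨caps n, isDiagram_caps n⟩, isHandle_caps n, rfl⟩
  comp T T' := ⟨Tangle.handleComp side T.1 T'.1, by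
    obtain ⟨_, D', hD', rfl⟩ := T'
    obtain ⟨_, D, hD, rfl⟩ := T
    exact ⟨⟨handleCompWord side _ D.1 D'.1, _⟩, hD.comp side hD', rfl⟩⟩
  tensor {m n} T T' := ⟨Tangle.tensor (Nat.mul_add 2 m n).symm rfl T.1 T'.1, by
    obtain ⟨_, D', hD', rfl⟩ := T'
    obtain ⟨_, D, hD, rfl⟩ := T
    exact ⟨⟨D.1 ++ shift _ D'.1, _⟩, hD.tensor hD', rfl⟩⟩

/-- The map `F` on string links. -/
def toHandle (side : Bool) (n : ℕ) (S : RSL n) : RHand side n :=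
  ⟨Tangle.bend side S.1, by
    obtain ⟨_, D, hD, rfl⟩ := S
    exact ⟨⟨bendWord side _ D.1, _⟩, hD.bend side, rfl⟩⟩

/-- The map `G` on handles. -/
def toStringLink (side : Bool) (n : ℕ) (T : RHand side n) : RSL n :=
  ⟨Tangle.unbend side T.1, by
    obtain ⟨_, D, hD, rfl⟩ := T
    exact ⟨⟨unbendWord side _ D.1, _⟩, hD.unbend side, rfl⟩⟩

end RibbonTangle

namespace RibbonTangle

/-! ### Isotopies of words -/

/-! The proof treats the arcs that $F$ and $G$ add as a duality on $n$ parallel strands. Call a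
group of $n$ strands a cable. `pairing` joins two adjacent cables by $n$ local maxima, `copairing`
creates two adjacent cables by $n$ local minima, and `Iso.copairing_pairing` is the zigzag identity
for cables. After unshuffling the inputs $1,2,\dots,2n$ into a left and a right cable, $F(S)$ is `S`
on the right cable followed by `pairing`. The remaining braids are rewritten in these terms. In
$G(F(S))$ the base of $G$ followed by the unshuffle is just `copairing`
(`Iso.unbendBase_unshuffle`). In $F(G(T))$ the arcs below and above `T` cancel against each other
(`Iso.unshuffle_unbendBase_pairing`). In $F(S')\circ F(S)$ the base of the composite inserts a
`copairing` between the two cables (`Iso.insertCups_unshuffle`). In each case a tangle slides past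
arcs beside it, a zigzag is straightened, and the expected result is left.

The one geometric input is naturality of a strand that passes entirely behind, or entirely in front
of, everything it meets: it can be pulled across any tangle (`Iso.shift_append_strandLeft`). This is
why one side is fixed throughout and why the proof is the same for both choices. The explicit
isotopies use only deformation and moves of types 2 and 3.

The identities on cables are proved by induction on $n$, peeling off the last arc, straightening it,
and pulling the resulting strand across the arcs that remain.

The rest is formal. The laws for string links are read off from stacking and juxtaposition. The map
$F$ is a bijection with inverse $G$ and preserves identities, composition and juxtaposition, so it
carries these laws over to handles; associativity of the composition of handles never has to be
drawn. The inverse of $F$ is then automatically a strict monoidal functor. -/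

theorem isDiagram_cons_iff {m n i : ℕ} {p : Piece} {w : Word} :
    IsDiagram m (⟨i, p⟩ :: w) n ↔
      ∃ r, m = i + p.ins + r ∧ IsDiagram (i + p.outs + r) w n := by
  constructor
  · intro h
    cases h with
    | cons _ r _ _ _ h => exact ⟨r, rfl, h⟩
  · rintro ⟨r, rfl, h⟩
    exact IsDiagram.cons _ _ _ _ _ h

theorem isDiagram_nil_iff {m n : ℕ} : IsDiagram m [] n ↔ m = n := by
  constructor
  · intro h; cases h; rfl
  · rintro rfl; exact IsDiagram.nil _

/-- The converse fails: the right side of a zigzag or of a move of type 2 is empty, so it does not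
force the strands of the left side to exist. This asymmetry is why `LocalStep` requires the left
side to be a diagram. -/
theorem Move.isDiagram {x y : Word} (h : Move x y) {m n : ℕ} (hx : IsDiagram m x n) :
    IsDiagram m y n := by
  cases h with
  | exchange i d p q =>
    simp only [isDiagram_cons_iff, isDiagram_nil_iff] at hx ⊢
    obtain ⟨r, h1, r', h2, h3⟩ := hx
    exact ⟨r', by omega, q.outs + d + r', by omega, by omega⟩
  | zigzag_left i | zigzag_right i | reidemeister_two i b =>
    simp only [isDiagram_cons_iff, isDiagram_nil_iff, Piece.ins, Piece.outs] at hx ⊢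
    omega
  | slide_cap i b =>
    simp only [isDiagram_cons_iff, isDiagram_nil_iff, Piece.ins, Piece.outs] at hx ⊢
    obtain ⟨r, h1, r', h2, h3⟩ := hx
    -- Here and in the next cases the witnesses count the strands to the right of each new piece:
    -- the total on that line, minus the position, minus the inputs of the piece.
    exact ⟨m - i - 3, by omega, m - i - 2, by omega, by omega⟩
  | slide_cup i b =>
    simp only [isDiagram_cons_iff, isDiagram_nil_iff, Piece.ins, Piece.outs] at hx ⊢
    obtain ⟨r, h1, r', h2, h3⟩ := hx
    exact ⟨m - i - 0, by omega, m - i - 1, by omega, by omega⟩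
  | reidemeister_one i b =>
    simp only [isDiagram_cons_iff, isDiagram_nil_iff, Piece.ins, Piece.outs] at hx ⊢
    obtain ⟨r, h1, r', h2, r'', h3, h4⟩ := hx
    exact ⟨m - i, by omega, m - i - 1, by omega, m - i, by omega, by omega⟩
  | reidemeister_three i b =>
    simp only [isDiagram_cons_iff, isDiagram_nil_iff, Piece.ins, Piece.outs] at hx ⊢
    obtain ⟨r, h1, r', h2, r'', h3, h4⟩ := hx
    exact ⟨m - i - 3, by omega, m - i - 2, by omega, m - i - 3, by omega, by omega⟩

/-- An elementary move inside a word whose part below the move, and the moved part, are diagrams,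
with `m` bottom endpoints. -/
def LocalStep (m : ℕ) (a b : Word) : Prop :=
  ∃ u x y v : Word, ∃ k l : ℕ, IsDiagram m u k ∧ IsDiagram k x l ∧ Move x y ∧
    a = u ++ x ++ v ∧ b = u ++ y ++ v

/-- Isotopy of words with `m` bottom endpoints. -/
def Iso (m : ℕ) : Word → Word → Prop := Relation.EqvGen (LocalStep m)

namespace Iso

variable {m n k : ℕ} {a b c u v w : Word}

@[refl] theorem refl (m : ℕ) (w : Word) : Iso m w w := Relation.EqvGen.refl w

@[symm] theorem symm (h : Iso m a b) : Iso m b a := Relation.EqvGen.symm _ _ h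

@[trans] theorem trans (h : Iso m a b) (h' : Iso m b c) : Iso m a c :=
  Relation.EqvGen.trans _ _ _ h h'

instance : Trans (Iso m) (Iso m) (Iso m) := ⟨trans⟩

theorem of_eq (h : a = b) : Iso m a b := h ▸ refl m a

theorem map {m' : ℕ} (f : Word → Word) (hf : ∀ a b, LocalStep m a b → Iso m' (f a) (f b))
    (h : Iso m a b) : Iso m' (f a) (f b) := by
  induction h with
  | rel _ _ h => exact hf _ _ h
  | refl _ => exact refl _ _
  | symm _ _ _ ih => exact ih.symm
  | trans _ _ _ _ _ ih ih' => exact ih.trans ih'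

/-- Nothing is required of the part above a move, so any word may be put on top, diagram or not. -/
theorem append_right (h : Iso m a b) (v : Word) : Iso m (a ++ v) (b ++ v) := by
  refine h.map (· ++ v) ?_
  rintro _ _ ⟨u, x, y, v', k, l, hu, hx, hm, rfl, rfl⟩
  exact .rel _ _ ⟨u, x, y, v' ++ v, k, l, hu, hx, hm, by simp, by simp⟩

theorem append_left (hu : IsDiagram k u m) (h : Iso m a b) : Iso k (u ++ a) (u ++ b) := by
  refine h.map (u ++ ·) ?_
  rintro _ _ ⟨u', x, y, v', k, l, hu', hx, hm, rfl, rfl⟩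
  exact .rel _ _ ⟨u ++ u', x, y, v', k, l, hu.append hu', hx, hm, by simp, by simp⟩

/-- Replace a part of a word. -/
theorem ctx {w w' : Word} (h : Iso k a b) (u v : Word) (hu : IsDiagram m u k)
    (h1 : w = u ++ (a ++ v) := by simp) (h2 : w' = u ++ (b ++ v) := by simp) : Iso m w w' := by
  subst h1 h2
  exact append_left hu (h.append_right v)

/-- Replace a part of a word, and go on. -/
theorem step {w w' : Word} (h : Iso k a b) (u v : Word) (hu : IsDiagram m u k)
    (next : Iso m (u ++ (b ++ v)) w') (h1 : w = u ++ (a ++ v) := by simp) : Iso m w w' := by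
  subst h1
  exact (append_left hu (h.append_right v)).trans next

theorem map_shift (h : Iso m a b) (s : ℕ) : Iso (s + m) (shift s a) (shift s b) := by
  refine h.map (shift s) ?_
  rintro _ _ ⟨u, x, y, v, k, l, hu, hx, hm, rfl, rfl⟩
  exact .rel _ _ ⟨_, _, _, shift s v, _, _, hu.shift s, hx.shift s, hm.shift s,
    by simp [shift], by simp [shift]⟩

/-- A slice does not record the strands on its right, so the same moves remain valid when more are
present. -/
theorem addRight (h : Iso m a b) (e : ℕ) : Iso (m + e) a b := by
  refine h.map (fun w => w) ?_
  rintro _ _ ⟨u, x, y, v, k, l, hu, hx, hm, rfl, rfl⟩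
  exact .rel _ _ ⟨u, x, y, v, _, _, hu.addRight e, hx.addRight e, hm, rfl, rfl⟩

theorem mono (h : Iso m a b) (hk : m ≤ k) : Iso k a b := by
  obtain ⟨e, rfl⟩ := Nat.exists_eq_add_of_le hk
  exact h.addRight e

/-- Both sides of the replaced part are diagrams with the same ends, and the top ends of a diagram
are determined by its bottom ends; hence the untouched upper part sees the same number of strands
either way. -/
theorem _root_.RibbonTangle.LocalStep.isDiagram_iff (h : LocalStep m a b) :
    IsDiagram m a n ↔ IsDiagram m b n := by
  obtain ⟨u, x, y, v, k, l, hu, hx, hm, rfl, rfl⟩ := h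
  have h1 := hu.append hx
  have h2 := hu.append (hm.isDiagram hx)
  constructor
  · intro h
    obtain ⟨j, h3, h4⟩ := h.of_append
    rw [h3.unique h1] at h4
    exact h2.append h4
  · intro h
    obtain ⟨j, h3, h4⟩ := h.of_append
    rw [h3.unique h2] at h4
    exact h1.append h4

theorem isDiagram_iff (h : Iso m a b) : IsDiagram m a n ↔ IsDiagram m b n := by
  induction h with
  | rel _ _ h => exact h.isDiagram_iff
  | refl _ => exact Iff.rfl
  | symm _ _ _ ih => exact ih.symm
  | trans _ _ _ _ _ ih ih' => exact ih.trans ih'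

/-- Isotopic diagrams represent the same tangle. -/
theorem mk_eq (h : Iso m a b) (ha : IsDiagram m a n) (hb : IsDiagram m b n) :
    (Quot.mk _ ⟨a, ha⟩ : Tangle m n) = Quot.mk _ ⟨b, hb⟩ := by
  induction h with
  | rel _ _ h =>
    obtain ⟨u, x, y, v, k, l, hu, hx, hm, rfl, rfl⟩ := h
    exact Quot.sound ⟨u, x, y, v, hm, rfl, rfl⟩
  | refl _ => rfl
  | symm _ _ _ ih => exact (ih hb ha).symm
  | trans _ _ _ h _ ih ih' =>
    -- The middle word of a chain must itself be a diagram before it can represent a class in the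
    -- quotient.
    have hc := (Iso.isDiagram_iff h).1 ha
    exact (ih ha hc).trans (ih' hc hb)

theorem of_move (h : Move a b) (ha : IsDiagram m a n) : Iso m a b :=
  .rel _ _ ⟨[], a, b, [], m, n, IsDiagram.nil m, ha, h, by simp, by simp⟩

end Iso

/-! ### Mirror images and shifts of words -/

@[simp] theorem flip_nil : flip [] = [] := rfl

@[simp] theorem flip_append (u v : Word) : flip (u ++ v) = flip v ++ flip u := by
  simp [flip]

theorem flip_cons (i : ℕ) (p : Piece) (w : Word) :
    flip (⟨i, p⟩ :: w) = flip w ++ [⟨i, p.flip⟩] := by simp [flip]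

@[simp] theorem shift_nil (s : ℕ) : shift s [] = [] := rfl

@[simp] theorem shift_cons (s i : ℕ) (p : Piece) (w : Word) :
    shift s (⟨i, p⟩ :: w) = ⟨s + i, p⟩ :: shift s w := rfl

@[simp] theorem shift_append (s : ℕ) (u v : Word) : shift s (u ++ v) = shift s u ++ shift s v := by
  simp [shift]

@[simp] theorem shift_shift (s t : ℕ) (w : Word) : shift s (shift t w) = shift (s + t) w := by
  simp [shift, Nat.add_assoc]

@[simp] theorem shift_zero (w : Word) : shift 0 w = w := by simp [shift]

theorem flip_shift (s : ℕ) (w : Word) : flip (shift s w) = shift s (flip w) := by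
  simp [flip, shift]

@[simp] theorem Piece.flip_flip (p : Piece) : p.flip.flip = p := by cases p <;> simp [Piece.flip]

@[simp] theorem flip_flip (w : Word) : flip (flip w) = w := by
  induction w with
  | nil => rfl
  | cons x w ih => obtain ⟨i, p⟩ := x; simp [flip_cons, ih]

theorem shift_strandLeft (side : Bool) (s i x : ℕ) :
    shift s (strandLeft side i x) = strandLeft side (s + i) x := by
  induction x with
  | zero => rfl
  | succ x ih => simp [strandLeft, ih, Nat.add_assoc]

/-- The moving strand comes from the right, so it meets the `y` rightmost strands first. Long
passages are cut and glued with this identity. -/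
theorem strandLeft_add (side : Bool) (i x y : ℕ) :
    strandLeft side i (x + y) = strandLeft side (i + x) y ++ strandLeft side i x := by
  induction y with
  | zero => rfl
  | succ y ih => simp [strandLeft, ih, Nat.add_assoc]

/-! ### Short diagrams inside a given number of strands -/

theorem isDiagram_piece {m n i : ℕ} {p : Piece} (h : i + p.ins ≤ m) (hn : m + p.outs = n + p.ins) :
    IsDiagram m [⟨i, p⟩] n :=
  IsDiagram.single i (m - i - p.ins) p (by omega) (by omega)

theorem isDiagram_cup {m i : ℕ} (h : i ≤ m) : IsDiagram m [⟨i, .cup⟩] (m + 2) :=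
  isDiagram_piece h rfl

theorem isDiagram_cap {m i : ℕ} (h : i ≤ m) : IsDiagram (m + 2) [⟨i, .cap⟩] m :=
  isDiagram_piece (by simpa [Piece.ins]) rfl

theorem isDiagram_cross {m i : ℕ} (b : Bool) (h : i + 2 ≤ m) : IsDiagram m [⟨i, .cross b⟩] m :=
  isDiagram_piece h rfl

theorem IsDiagram.mono {m k : ℕ} {w : Word} (h : IsDiagram m w m) (hk : m ≤ k) :
    IsDiagram k w k := by
  obtain ⟨e, rfl⟩ := Nat.exists_eq_add_of_le hk
  exact h.addRight e

theorem isDiagram_strandLeft_of_lt (side : Bool) {m i x : ℕ} (h : i + x < m) :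
    IsDiagram m (strandLeft side i x) m :=
  (isDiagram_strandLeft side i x).mono h

theorem isDiagram_flip_strandLeft_of_lt (side : Bool) {m i x : ℕ} (h : i + x < m) :
    IsDiagram m (flip (strandLeft side i x)) m :=
  (isDiagram_strandLeft_of_lt side h).flip

theorem isDiagram_block_of_le (side : Bool) {m i x y : ℕ} (h : i + x + y ≤ m) :
    IsDiagram m (block side i x y) m :=
  (isDiagram_block side i x y).mono h

/-! ### The basic isotopies -/

/-- The position of `q` is `j` when counted above `p`; below `p` the outputs of `p` are replaced by
its inputs. The subtraction is never truncated, because `p.outs ≤ j`. -/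
theorem Iso.exchange {m i j : ℕ} (p q : Piece) (h : i + p.outs ≤ j)
    (hm : j + q.ins + p.ins ≤ m + p.outs) :
    Iso m ([⟨i, p⟩] ++ [⟨j, q⟩]) ([⟨j + p.ins - p.outs, q⟩] ++ [⟨i, p⟩]) := by
  obtain ⟨d, rfl⟩ := Nat.exists_eq_add_of_le h
  rw [show i + p.outs + d + p.ins - p.outs = i + p.ins + d by omega]
  exact Iso.of_move (Move.exchange i d p q) (n := m - p.ins + p.outs - q.ins + q.outs)
    ((isDiagram_piece (n := m - p.ins + p.outs) (by omega) (by omega)).append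
      (isDiagram_piece (by omega) (by omega)))

theorem Iso.zigzag_left {m : ℕ} (i : ℕ) (h : i < m) :
    Iso m ([⟨i, .cup⟩] ++ [⟨i + 1, .cap⟩]) [] :=
  .of_move (.zigzag_left i) ((isDiagram_cup (by omega)).append (isDiagram_cap (m := m) (by omega)))

theorem Iso.zigzag_right {m : ℕ} (i : ℕ) (h : i < m) :
    Iso m ([⟨i + 1, .cup⟩] ++ [⟨i, .cap⟩]) [] :=
  .of_move (.zigzag_right i) ((isDiagram_cup (by omega)).append (isDiagram_cap (m := m) (by omega)))

theorem Iso.slide_cap {m : ℕ} (i : ℕ) (b : Bool) (h : i + 3 ≤ m) :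
    Iso m ([⟨i, .cross b⟩] ++ [⟨i + 1, .cap⟩]) ([⟨i + 1, .cross (!b)⟩] ++ [⟨i, .cap⟩]) :=
  .of_move (.slide_cap i b) (n := m - 2) ((isDiagram_cross b (by omega)).append
    (isDiagram_piece (by simp [Piece.ins]; omega) (by simp [Piece.ins, Piece.outs]; omega)))

theorem Iso.slide_cup {m : ℕ} (i : ℕ) (b : Bool) (h : i + 1 ≤ m) :
    Iso m ([⟨i + 1, .cup⟩] ++ [⟨i, .cross b⟩]) ([⟨i, .cup⟩] ++ [⟨i + 1, .cross (!b)⟩]) :=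
  .of_move (.slide_cup i b) ((isDiagram_cup (by omega)).append (isDiagram_cross b (by omega)))

theorem Iso.cross_cancel {m : ℕ} (i : ℕ) (b : Bool) (h : i + 2 ≤ m) :
    Iso m ([⟨i, .cross b⟩] ++ [⟨i, .cross (!b)⟩]) [] :=
  .of_move (.reidemeister_two i b) ((isDiagram_cross b h).append (isDiagram_cross _ h))

theorem Iso.cross_cancel' {m : ℕ} (i : ℕ) (b : Bool) (h : i + 2 ≤ m) :
    Iso m ([⟨i, .cross (!b)⟩] ++ [⟨i, .cross b⟩]) [] := by
  simpa using Iso.cross_cancel i (!b) h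

theorem Iso.braid {m : ℕ} (i : ℕ) (b : Bool) (h : i + 3 ≤ m) :
    Iso m ([⟨i, .cross b⟩] ++ ([⟨i + 1, .cross b⟩] ++ [⟨i, .cross b⟩]))
      ([⟨i + 1, .cross b⟩] ++ ([⟨i, .cross b⟩] ++ [⟨i + 1, .cross b⟩])) :=
  .of_move (.reidemeister_three i b) ((isDiagram_cross b (by omega)).append
    ((isDiagram_cross b (by omega)).append (isDiagram_cross b (by omega))))

/-- Pieces which are next to each other can be moved vertically. -/
theorem Iso.interchange {a b c d m : ℕ} {u v : Word} (hu : IsDiagram a u b) (hv : IsDiagram c v d)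
    (hm : a + c ≤ m) : Iso m (u ++ shift b v) (shift a v ++ u) := by
  induction hu generalizing m with
  | nil n => simpa using Iso.refl _ _
  | cons l r p w n hw ih =>
    -- One slice of `u` is moved past all of `v`, by induction on `v`; the outer induction then
    -- treats the slices of `u` one at a time.
    have h1 : Iso m ([⟨l, p⟩] ++ shift (l + p.outs + r) v) (shift (l + p.ins + r) v ++ [⟨l, p⟩]) := by
      clear ih
      induction hv generalizing m with
      | nil n => exact Iso.refl _ _
      | cons l' r' q v' n' _ ih' =>
        have h2 := Iso.exchange (m := m) (i := l) (j := l + p.outs + r + l') p q (by omega) (by omega)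
        rw [show l + p.outs + r + l' + p.ins - p.outs = l + p.ins + r + l' by omega] at h2
        refine h2.step [] (shift (l + p.outs + r) v') (IsDiagram.nil _) ?_
        refine (ih' (m := m - q.ins + q.outs) (by omega)).ctx [⟨l + p.ins + r + l', q⟩] []
          (isDiagram_piece (by omega) (by omega)) (by simp) (by simp)
    refine (ih (m := m - p.ins + p.outs) (by omega)).step [⟨l, p⟩] []
      (isDiagram_piece (by omega) (by omega)) ?_
    exact h1.ctx [] w (IsDiagram.nil _)

/-- Here `i` and `j` are the positions of one piece counted below and above `u`. The relation
between them is written as `j + a = i + b` to avoid subtraction. -/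
theorem Iso.interchange_piece {m a b i j : ℕ} {u : Word} (hu : IsDiagram a u b) {p : Piece}
    (hi : a ≤ i) (hm : i + p.ins ≤ m) (hj : j + a = i + b) :
    Iso m (u ++ [⟨j, p⟩]) ([⟨i, p⟩] ++ u) := by
  have h := Iso.interchange (m := m) hu (isDiagram_piece (m := m - a) (i := i - a) (p := p)
    (n := m - a - p.ins + p.outs) (by omega) (by omega)) (by omega)
  simp only [shift_cons, shift_nil] at h
  rwa [show b + (i - a) = j by omega, show a + (i - a) = i by omega] at h

theorem Iso.interchange_strandLeft {m a b i j x : ℕ} (side : Bool) {u : Word}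
    (hu : IsDiagram a u b) (hi : a ≤ i) (hm : i + x < m) (hj : j + a = i + b) :
    Iso m (u ++ strandLeft side j x) (strandLeft side i x ++ u) := by
  have h := Iso.interchange (m := m) hu (isDiagram_strandLeft_of_lt side (m := m - a) (i := i - a)
    (x := x) (by omega)) (by omega)
  rwa [shift_strandLeft, shift_strandLeft, show b + (i - a) = j by omega,
    show a + (i - a) = i by omega] at h

theorem Iso.interchange_flip_strandLeft {m a b i j x : ℕ} (side : Bool) {u : Word}
    (hu : IsDiagram a u b) (hi : a ≤ i) (hm : i + x < m) (hj : j + a = i + b) :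
    Iso m (u ++ flip (strandLeft side j x)) (flip (strandLeft side i x) ++ u) := by
  have h := Iso.interchange (m := m) hu (isDiagram_flip_strandLeft_of_lt side (m := m - a)
    (i := i - a) (x := x) (by omega)) (by omega)
  rwa [← flip_shift, ← flip_shift, shift_strandLeft, shift_strandLeft,
    show b + (i - a) = j by omega, show a + (i - a) = i by omega] at h

/-- A braid and its mirror image cancel from the middle outwards, by moves of type 2. -/
theorem Iso.append_flip {m n : ℕ} {w : Word} (hw : ∀ x ∈ w, ∃ b, x.piece = .cross b)
    (h : IsDiagram m w n) : Iso m (w ++ flip w) [] := by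
  induction h with
  | nil n => exact Iso.refl _ _
  | cons l r p w n hd ih =>
    obtain ⟨b, hb⟩ := hw _ List.mem_cons_self
    obtain rfl : p = .cross b := hb
    have ih := ih fun x hx => hw x (List.mem_cons_of_mem _ hx)
    refine ih.step [⟨l, .cross b⟩] [⟨l, .cross !b⟩] (IsDiagram.single l r _ rfl rfl) ?_
      (by simp [flip_cons, Piece.flip])
    exact (Iso.cross_cancel l b (by simp [Piece.ins])).ctx [] [] (IsDiagram.nil _)

theorem Iso.flip_append_self {m n : ℕ} {w : Word} (hw : ∀ x ∈ w, ∃ b, x.piece = .cross b)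
    (h : IsDiagram m w n) : Iso n (flip w ++ w) [] := by
  simpa using Iso.append_flip (flip_cross hw) h.flip

theorem Iso.strandLeft_append_flip (side : Bool) {m : ℕ} (i x : ℕ) (h : i + x < m) :
    Iso m (strandLeft side i x ++ flip (strandLeft side i x)) [] :=
  Iso.append_flip (strandLeft_cross side i x) (isDiagram_strandLeft_of_lt side h)

theorem Iso.flip_append_strandLeft (side : Bool) {m : ℕ} (i x : ℕ) (h : i + x < m) :
    Iso m (flip (strandLeft side i x) ++ strandLeft side i x) [] :=
  Iso.flip_append_self (strandLeft_cross side i x) (isDiagram_strandLeft_of_lt side h)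

/-- The set of moves is symmetric under reflection, except that an exchange of heights comes out
reversed; hence the disjunction. -/
theorem Move.map_flip {x y : Word} (h : Move x y) :
    Move (flip x) (flip y) ∨ Move (flip y) (flip x) := by
  cases h with
  | exchange i d p q =>
    right
    have := Move.exchange i d p.flip q.flip
    rwa [Piece.ins_flip, Piece.outs_flip] at this
  | zigzag_left i => exact .inl (.zigzag_right i)
  | zigzag_right i => exact .inl (.zigzag_left i)
  | slide_cap i b => exact .inl (by simpa [flip, Piece.flip] using Move.slide_cup i (!b))
  | slide_cup i b => exact .inl (by simpa [flip, Piece.flip] using Move.slide_cap i (!b))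
  | reidemeister_one i b => exact .inl (.reidemeister_one i (!b))
  | reidemeister_two i b =>
    exact .inl (by simpa [flip, Piece.flip] using Move.reidemeister_two i b)
  | reidemeister_three i b => exact .inl (.reidemeister_three i (!b))

/-- Reflection turns the part above a move into the part below it, and that part must be a diagram.
Hence all of `a` is required to be one. -/
theorem Iso.map_flip {m n : ℕ} {a b : Word} (h : Iso m a b) (ha : IsDiagram m a n) :
    Iso n (flip a) (flip b) := by
  induction h with
  | rel a b h =>
    obtain ⟨u, x, y, v, k, l, hu, hx, hm, rfl, rfl⟩ := h
    obtain ⟨l', h1, h2⟩ := ha.of_append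
    obtain rfl := h1.unique (hu.append hx)
    have key : Iso l' (flip x) (flip y) := by
      rcases hm.map_flip with h | h
      · exact .of_move h hx.flip
      · exact (Iso.of_move h (hm.isDiagram hx).flip).symm
    exact key.ctx _ (flip u) h2.flip
  | refl _ => exact refl _ _
  | symm _ _ h ih => exact (ih ((Iso.isDiagram_iff h).2 ha)).symm
  | trans _ _ _ h _ ih ih' => exact (ih ha).trans (ih' ((Iso.isDiagram_iff h).1 ha))

/-! ### Strands passing behind or in front of a tangle -/

/-- Across an extremum, the extremum is slid past one of the two crossings and the resulting
opposite pair cancels. Across a crossing this is a move of type 3, in any of its versions, because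
the moving strand lies behind both other strands or in front of both. -/
theorem Iso.piece_strandLeft (side : Bool) {m : ℕ} (i : ℕ) (p : Piece) (h : i + p.ins < m) :
    Iso m ([⟨i, p⟩] ++ strandLeft side i p.outs) (strandLeft side i p.ins ++ [⟨i + 1, p⟩]) := by
  cases p with
  | cup =>
    simp only [Piece.ins, Piece.outs, strandLeft] at h ⊢
    have h1 := Iso.slide_cup (m := m) i (!side) (by omega)
    rw [Bool.not_not] at h1
    refine h1.symm.step [] [⟨i, .cross side⟩] (.nil _) ?_
    exact (Iso.cross_cancel' i side (by omega)).ctx [⟨i + 1, .cup⟩] [] (isDiagram_cup (by omega))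
  | cap =>
    simp only [Piece.ins, Piece.outs, strandLeft] at h ⊢
    symm
    refine (Iso.slide_cap i side (by omega)).step [⟨i + 1, .cross side⟩] []
      (isDiagram_cross (m := m) _ (by omega)) ?_
    exact (Iso.cross_cancel (i + 1) side (by omega)).ctx [] [⟨i, .cap⟩] (.nil _)
  | cross b =>
    simp only [Piece.ins, Piece.outs, strandLeft] at h ⊢
    have d : ∀ {j : ℕ} (c : Bool), j < i + 2 → IsDiagram m [⟨j, .cross c⟩] m :=
      fun c hj => isDiagram_cross c (by omega)
    obtain rfl | rfl : b = side ∨ b = !side := by cases b <;> cases side <;> simp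
    · exact (Iso.braid i b (by omega)).ctx [] [] (.nil _)
    -- `Move.reidemeister_three` has three crossings of the same sign. For the other sign of `b`, a
    -- cancelling pair is created on top; the move is applied to its lower half and the two
    -- crossings below it, and the new lowest crossing cancels against `b`.
    · refine (Iso.cross_cancel (i + 1) side (by omega)).symm.step
        [⟨i, .cross !side⟩, ⟨i + 1, .cross side⟩, ⟨i, .cross side⟩] []
        ((d _ (by omega)).append ((d _ (by omega)).append (d _ (by omega)))) ?_
      refine (Iso.braid i side (by omega)).symm.step [⟨i, .cross !side⟩] [⟨i + 1, .cross !side⟩]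
        (d _ (by omega)) ?_
      exact (Iso.cross_cancel' i side (by omega)).ctx [] [⟨i + 1, .cross side⟩, ⟨i, .cross side⟩,
        ⟨i + 1, .cross !side⟩] (.nil _)

/-- The passage is cut into its crossings with the `r` strands on the right, with the piece, and
with the `l` strands on the left. The outer two commute with the piece, and the middle one is
`Iso.piece_strandLeft`. When the strand has arrived on the left, the piece is one place further
right. -/
theorem Iso.layer_strandLeft (side : Bool) {m : ℕ} (i l r : ℕ) (p : Piece)
    (h : i + (l + p.ins + r) < m) :
    Iso m ([⟨i + l, p⟩] ++ strandLeft side i (l + p.outs + r))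
      (strandLeft side i (l + p.ins + r) ++ [⟨i + 1 + l, p⟩]) := by
  simp only [strandLeft_add]
  have h1 := Iso.interchange_strandLeft side (m := m) (i := i + (l + p.ins)) (x := r)
    (j := i + (l + p.outs))
    (isDiagram_piece (m := i + l + p.ins) (i := i + l) (p := p) (n := i + l + p.outs) le_rfl
      (by omega)) (by omega) (by omega) (by omega)
  refine h1.step [] (strandLeft side (i + l) p.outs ++ strandLeft side i l) (.nil _) ?_
  refine (Iso.piece_strandLeft side (i + l) p (by omega)).step
    (strandLeft side (i + (l + p.ins)) r) (strandLeft side i l)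
    (isDiagram_strandLeft_of_lt (m := m) side (by omega)) ?_
  have h2 := Iso.interchange_piece (m := m) (i := i + l + 1) (j := i + l + 1) (p := p)
    (isDiagram_strandLeft side i l) le_rfl (by omega) rfl
  refine h2.symm.ctx (strandLeft side (i + (l + p.ins)) r ++ strandLeft side (i + l) p.ins) []
    ((isDiagram_strandLeft_of_lt side (by omega)).append
      (isDiagram_strandLeft_of_lt side (by omega))) (by simp) ?_
  simp [Nat.add_right_comm]

/-- A strand moves left behind (or in front of) a tangle. -/
theorem Iso.shift_append_strandLeft (side : Bool) {m x y : ℕ} (i : ℕ) {w : Word}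
    (hw : IsDiagram x w y) (h : i + x < m) :
    Iso m (shift i w ++ strandLeft side i y) (strandLeft side i x ++ shift (i + 1) w) := by
  induction hw generalizing m with
  | nil n => simpa using Iso.refl _ _
  | cons l r p w n hd ih =>
    refine (ih (m := m - p.ins + p.outs) (by omega)).step [⟨i + l, p⟩] []
      (isDiagram_piece (by omega) (by omega)) ?_
    exact (Iso.layer_strandLeft side i l r p h).ctx [] (shift (i + 1) w) (.nil _)

/-- A strand moves right behind (or in front of) a tangle. -/
theorem Iso.shift_append_flip_strandLeft (side : Bool) {m x y : ℕ} (i : ℕ) {w : Word}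
    (hw : IsDiagram x w y) (h : i + x < m) :
    Iso m (shift (i + 1) w ++ flip (strandLeft side i y))
      (flip (strandLeft side i x) ++ shift i w) := by
  obtain ⟨e, rfl⟩ := Nat.exists_eq_add_of_lt h
  have h1 := isDiagram_flip_strandLeft_of_lt side (m := i + x + e + 1) (i := i) (x := x) (by omega)
  -- The passage to the right is the inverse of the passage to the left: conjugate the previous
  -- lemma by it, creating a cancelling pair below `w` and removing one above.
  refine (Iso.flip_append_strandLeft side i x h).symm.step [] (shift (i + 1) w ++
    flip (strandLeft side i y)) (.nil _) ?_
  refine (Iso.shift_append_strandLeft side i hw (by omega)).symm.step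
    (flip (strandLeft side i x)) (flip (strandLeft side i y)) h1 ?_
  exact (Iso.strandLeft_append_flip side i y (m := i + y + (e + 1)) (by omega)).ctx
    (flip (strandLeft side i x) ++ shift i w) []
    (h1.append (((hw.shift i).addRight (e + 1)).cast rfl rfl))

/-- Several strands move left behind (or in front of) a tangle. -/
theorem Iso.shift_append_block (side : Bool) {m x x' : ℕ} (i y : ℕ) {w : Word}
    (hw : IsDiagram x w x') (h : i + x + y ≤ m) :
    Iso m (shift i w ++ block side i x' y) (block side i x y ++ shift (i + y) w) := by
  induction y with
  | zero => simpa [block] using Iso.refl _ _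
  | succ y ih =>
    refine (ih (by omega)).step [] (strandLeft side (i + y) x') (.nil _) ?_ (by simp [block])
    exact (Iso.shift_append_strandLeft side (i + y) hw (by omega)).ctx (block side i x y) []
      (isDiagram_block_of_le side (by omega)) (by simp) (by simp [block, Nat.add_assoc])

/-- A local minimum moves left behind (or in front of) some strands. -/
theorem Iso.cup_strandLeft_strandLeft (side : Bool) {m : ℕ} (i x : ℕ) (h : i + x ≤ m) :
    Iso m ([⟨i + x, .cup⟩] ++ (strandLeft side i x ++ strandLeft side (i + 1) x)) [⟨i, .cup⟩] := by
  induction x with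
  | zero => simpa [strandLeft] using Iso.refl _ _
  | succ x ih =>
    have h0 : IsDiagram m [⟨i + x + 1, .cup⟩] (m + 2) := isDiagram_cup (by omega)
    -- The first crossing of the right end is lowered until it is next to the first crossing of the
    -- left end. Sliding the minimum makes these two crossings opposite, so they cancel, and the
    -- minimum has passed one strand.
    have h1 := Iso.interchange_piece (m := m + 2) (i := i + x + 1) (j := i + x + 1)
      (p := .cross side) (isDiagram_strandLeft side i x) le_rfl (by simp [Piece.ins]; omega) rfl
    refine h1.step [⟨i + x + 1, .cup⟩, ⟨i + x, .cross side⟩] (strandLeft side (i + 1) x)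
      (h0.append (isDiagram_cross _ (by omega))) ?_ ?_
    swap
    · simp [strandLeft, Nat.add_assoc, Nat.add_comm x 1]
    refine (Iso.slide_cup (i + x) side (by omega)).step [] ([⟨i + x + 1, .cross side⟩] ++
      (strandLeft side i x ++ strandLeft side (i + 1) x)) (.nil _) ?_
    refine (Iso.cross_cancel' (i + x + 1) side (m := m + 2) (by omega)).step [⟨i + x, .cup⟩]
      (strandLeft side i x ++ strandLeft side (i + 1) x) (isDiagram_cup (by omega)) ?_
    exact (ih (by omega)).ctx [] [] (.nil _)

/-- Pulling both ends left moves the whole minimum; undoing the passage of the right end gives this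
form. It trades a passage of one end for a passage of the other, which prepares the two zigzags
below. -/
theorem Iso.cup_strandLeft (side : Bool) {m : ℕ} (i x : ℕ) (h : i + x ≤ m) :
    Iso m ([⟨i + x, .cup⟩] ++ strandLeft side i x)
      ([⟨i, .cup⟩] ++ flip (strandLeft side (i + 1) x)) := by
  symm
  refine (Iso.cup_strandLeft_strandLeft side i x h).symm.step []
    (flip (strandLeft side (i + 1) x)) (.nil _) ?_
  exact (Iso.strandLeft_append_flip side (i + 1) x (m := m + 2) (by omega)).ctx
    ([⟨i + x, .cup⟩] ++ strandLeft side i x) []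
    ((isDiagram_cup h).append (isDiagram_strandLeft_of_lt side (by omega)))

/-- A zigzag stretched over `x` strands: once the crossings are transferred to the other end of the
minimum, the maximum commutes down to it and the plain zigzag is straightened. Only the displacement
of the strand remains. -/
theorem Iso.zigzag_strandLeft (side : Bool) {m : ℕ} (i x : ℕ) (h : i + x < m) :
    Iso m ([⟨i, .cup⟩] ++ (flip (strandLeft side (i + 1) x) ++ [⟨i + x + 1, .cap⟩]))
      (strandLeft side i x) := by
  refine (Iso.cup_strandLeft side i x (by omega)).symm.step [] [⟨i + x + 1, .cap⟩] (.nil _) ?_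
  have h1 := Iso.interchange_piece (m := m + 2) (i := i + x + 1) (j := i + x + 1) (p := .cap)
    (isDiagram_strandLeft side i x) le_rfl (by simp [Piece.ins]; omega) rfl
  refine h1.step [⟨i + x, .cup⟩] [] (isDiagram_cup (by omega)) ?_
  exact (Iso.zigzag_left (i + x) h).ctx [] (strandLeft side i x) (.nil _)

theorem Iso.zigzag_flip_strandLeft (side : Bool) {m : ℕ} (i x : ℕ) (h : i + x < m) :
    Iso m ([⟨i + 1 + x, .cup⟩] ++ (strandLeft side (i + 1) x ++ [⟨i, .cap⟩]))
      (flip (strandLeft side i x)) := by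
  refine (Iso.cup_strandLeft side (i + 1) x (by omega)).step [] [⟨i, .cap⟩] (.nil _) ?_
  have h1 := Iso.interchange_flip_strandLeft side (m := m + 2) (i := i + 2) (j := i) (x := x)
    (isDiagram_cap (m := i) (i := i) le_rfl) le_rfl (by omega) (by omega)
  refine h1.symm.step [⟨i + 1, .cup⟩] [] (isDiagram_cup (by omega)) ?_
  exact (Iso.zigzag_right i (by omega)).ctx [] (flip (strandLeft side i x)) (.nil _)


/-! ### Families of strands -/

theorem unshuffle_one_one_succ (side : Bool) (n : ℕ) :
    unshuffle side 1 1 (n + 1) = unshuffle side 1 1 n ++ strandLeft side n n := by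
  simp [unshuffle, block]

theorem unshuffle_one_two_succ (side : Bool) (n : ℕ) :
    unshuffle side 1 2 (n + 1) = unshuffle side 1 2 n ++ strandLeft side n (2 * n) := by
  simp [unshuffle, block, Nat.mul_comm]

theorem unshuffle_two_two_succ (side : Bool) (n : ℕ) :
    unshuffle side 2 2 (n + 1) = unshuffle side 2 2 n ++
      (strandLeft side (2 * n) (2 * n) ++ strandLeft side (2 * n + 1) (2 * n)) := by
  simp [unshuffle, block, Nat.mul_comm]

theorem isDiagram_unshuffle_of_le (side : Bool) {m p q n : ℕ} (h : n * (p + q) ≤ m) :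
    IsDiagram m (unshuffle side p q n) m :=
  (isDiagram_unshuffle side p q n).mono h

/-- The arcs of `bendWord`: they join the `k`-th of the first `n` strands to the `k`-th of the last
`n` strands by a local maximum. -/
def pairing (side : Bool) (n : ℕ) : Word := flip (unshuffle side 1 1 n) ++ caps n

/-- Arcs which join the `k`-th of the first `n` strands to the `k`-th of the last `n` strands by a
local minimum. -/
def copairing (side : Bool) (n : ℕ) : Word := insertCups 0 0 n ++ unshuffle side 1 1 n

/-- The lower part of `unbendWord`. -/
def unbendBase (side : Bool) (n : ℕ) : Word := insertCups 1 0 n ++ unshuffle side 1 2 n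

theorem isDiagram_pairing (side : Bool) {m k n : ℕ} (h : m = k + 2 * n) :
    IsDiagram m (pairing side n) k := by
  subst h
  exact (isDiagram_unshuffle_of_le side (by omega)).flip.append
    (((isDiagram_caps n).addRight k).cast (by omega) (by omega))

theorem isDiagram_copairing (side : Bool) {m k n : ℕ} (h : k = m + 2 * n) :
    IsDiagram m (copairing side n) k := by
  subst h
  exact (((isDiagram_insertCups 0 0 n le_rfl).addRight m).cast (by omega)
    (Nat.add_comm _ _)).append (isDiagram_unshuffle_of_le side (by omega)) |>.cast rfl (by omega)

theorem isDiagram_unbendBase (side : Bool) {m k n : ℕ} (hn : n ≤ m) (h : k = m + 2 * n) :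
    IsDiagram m (unbendBase side n) k := by
  obtain ⟨e, rfl⟩ := Nat.exists_eq_add_of_le hn
  subst h
  exact ((((isDiagram_insertCups 1 0 n (by omega)).addRight e).cast (by omega)
    rfl).append (isDiagram_unshuffle_of_le side (by omega))).cast rfl (by omega)

/-- Isolates the last arc. Its maximum has position `0` after the other `n` maxima and position `2 *
n` before them, since they absorb `2 * n` strands. -/
theorem Iso.pairing_succ (side : Bool) {m n : ℕ} (h : 2 * n + 2 ≤ m) :
    Iso m (pairing side (n + 1))
      (flip (strandLeft side n n) ++ ([⟨2 * n, .cap⟩] ++ pairing side n)) := by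
  have h1 := Iso.interchange_piece (m := m) (i := 2 * n) (j := 0) (p := .cap)
    (isDiagram_pairing side (m := 2 * n) (k := 0) (n := n) (by omega)) le_rfl
    (by simpa [Piece.ins]) (by omega)
  have h2 : caps (n + 1) = caps n ++ [⟨0, .cap⟩] := List.replicate_succ' ..
  exact h1.ctx (flip (strandLeft side n n)) []
    (isDiagram_flip_strandLeft_of_lt side (by omega))
    (by simp [pairing, unshuffle_one_one_succ, h2]) (by simp)

theorem Iso.copairing_succ (side : Bool) (m n : ℕ) :
    Iso m (copairing side (n + 1))
      (copairing side n ++ ([⟨2 * n, .cup⟩] ++ strandLeft side n n)) := by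
  have h1 := Iso.interchange_piece (m := m + 2 * n) (i := 2 * n) (j := 2 * n) (p := .cup)
    (isDiagram_unshuffle_of_le side (p := 1) (q := 1) (n := n) (m := 2 * n) (by omega)) le_rfl
    (by simp [Piece.ins]) rfl
  exact h1.symm.ctx (insertCups 0 0 n) (strandLeft side n n)
    (((isDiagram_insertCups 0 0 n le_rfl).addRight m).cast (by omega) (by omega))
    (by simp [copairing, unshuffle_one_one_succ, insertCups, Nat.mul_comm]) (by simp [copairing])

theorem Iso.unbendBase_succ (side : Bool) {m n : ℕ} (h : n + 1 ≤ m) :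
    Iso m (unbendBase side (n + 1))
      (unbendBase side n ++ ([⟨3 * n, .cup⟩] ++ strandLeft side n (2 * n))) := by
  have h1 := Iso.interchange_piece (m := m + 2 * n) (i := 3 * n) (j := 3 * n) (p := .cup)
    (isDiagram_unshuffle_of_le side (p := 1) (q := 2) (n := n) (m := 3 * n) (by omega)) le_rfl
    (by simp [Piece.ins]; omega) rfl
  exact h1.symm.ctx (insertCups 1 0 n) (strandLeft side n (2 * n))
    (((isDiagram_insertCups 1 0 n (by omega)).addRight (m - n)).cast (by omega) (by omega))
    (by simp [unbendBase, unshuffle_one_two_succ, insertCups, Nat.mul_comm]) (by simp [unbendBase])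

/-- The snake identity. -/
theorem Iso.copairing_pairing (side : Bool) {m n : ℕ} (h : n ≤ m) :
    Iso m (copairing side n ++ shift n (pairing side n)) [] := by
  induction n with
  | zero => exact Iso.refl _ _
  | succ n ih =>
    have dW : IsDiagram m (copairing side n) (m + 2 * n) := isDiagram_copairing side rfl
    have dc : IsDiagram (m + 2 * n) [⟨2 * n, .cup⟩] (m + 2 * n + 2) := isDiagram_cup (by omega)
    refine (Iso.copairing_succ side m n).step [] (shift (n + 1) (pairing side (n + 1))) (.nil _) ?_
    have hp := (Iso.pairing_succ side (m := m - (n + 1) + 2 * (n + 1)) (n := n)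
      (by omega)).map_shift (n + 1)
    rw [show n + 1 + (m - (n + 1) + 2 * (n + 1)) = m + 2 * n + 2 by omega] at hp
    refine hp.step (copairing side n ++ ([⟨2 * n, .cup⟩] ++ strandLeft side n n)) []
      (dW.append (dc.append (isDiagram_strandLeft_of_lt side (by omega)))) ?_
    simp only [shift_append, shift_cons, shift_nil, ← flip_shift, shift_strandLeft]
    have h1 := Iso.interchange_flip_strandLeft side (m := m + 2 * n + 2) (i := 2 * n + 1)
      (j := n + 1 + n) (x := n) (isDiagram_strandLeft side n n) (by omega) (by omega) (by omega)
    refine h1.step (copairing side n ++ [⟨2 * n, .cup⟩]) ([⟨n + 1 + 2 * n, .cap⟩] ++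
      shift (n + 1) (pairing side n)) (dW.append dc) ?_
    have h2 := Iso.interchange_piece (m := m + 2 * n + 2) (i := 3 * n + 1)
      (j := n + 1 + 2 * n) (p := .cap) (isDiagram_strandLeft side n n) (by omega)
      (by simp [Piece.ins]; omega) (by omega)
    refine h2.step (copairing side n ++ ([⟨2 * n, .cup⟩] ++ flip (strandLeft side (2 * n + 1) n)))
      (shift (n + 1) (pairing side n))
      (dW.append (dc.append (isDiagram_flip_strandLeft_of_lt side (by omega)))) ?_
    -- The last minimum and the last maximum now form one zigzag across `n` strands. It leaves a
    -- strand moving left, which joins the other passage into a single one across `2 * n` strands.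
    have h3 := Iso.zigzag_strandLeft side (m := m + 2 * n) (2 * n) n (by omega)
    rw [show 2 * n + n + 1 = 3 * n + 1 by omega] at h3
    refine h3.step (copairing side n) (strandLeft side n n ++ shift (n + 1) (pairing side n)) dW ?_
    have h4 := strandLeft_add side n n n
    rw [← two_mul] at h4
    -- This strand is pulled across the remaining maxima. They have no outputs, so no crossing is
    -- left.
    have h5 := Iso.shift_append_strandLeft side (m := m + 2 * n) n
      (isDiagram_pairing side (m := 2 * n) (k := 0) (n := n) (by omega)) (by omega)
    refine h5.symm.step (copairing side n) [] dW ?_ (by simp [h4])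
    exact (ih (by omega)).ctx [] [] (.nil _) (by simp [strandLeft])

/-- The minima of `unbendBase` start among the given strands. After the second ends are also
separated from those strands, both ends of each minimum pass on the same side, so the minimum can be
pulled to the far left. -/
theorem Iso.unbendBase_unshuffle (side : Bool) {m n : ℕ} (h : n ≤ m) :
    Iso m (unbendBase side n ++ shift n (unshuffle side 1 1 n)) (copairing side n) := by
  induction n with
  | zero => exact Iso.refl _ _
  | succ n ih =>
    have dL : IsDiagram m (unbendBase side n) (m + 2 * n) := isDiagram_unbendBase side (by omega) rfl
    have dc : IsDiagram (m + 2 * n) [⟨3 * n, .cup⟩] (m + 2 * n + 2) := isDiagram_cup (by omega)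
    have dU : IsDiagram (2 * n) (unshuffle side 1 1 n) (2 * n) :=
      isDiagram_unshuffle_of_le side (by omega)
    refine (Iso.unbendBase_succ side h).step [] (shift (n + 1) (unshuffle side 1 1 (n + 1)))
      (.nil _) ?_
    simp only [unshuffle_one_one_succ, shift_append, shift_strandLeft]
    have h1 := Iso.shift_append_strandLeft side (m := m + 2 * n + 2) n dU (by omega)
    refine h1.symm.step (unbendBase side n ++ [⟨3 * n, .cup⟩]) (strandLeft side (n + 1 + n) n)
      (dL.append dc) ?_
    have h2 := Iso.interchange_piece (m := m + 2 * n) (i := 3 * n) (j := 3 * n) (p := .cup)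
      (dU.shift n) (by omega) (by simp [Piece.ins]; omega) (by omega)
    refine h2.symm.step (unbendBase side n)
      (strandLeft side n (2 * n) ++ strandLeft side (n + 1 + n) n) dL ?_
    refine (ih (by omega)).step [] ([⟨3 * n, .cup⟩] ++
      (strandLeft side n (2 * n) ++ strandLeft side (n + 1 + n) n)) (.nil _) ?_
    have dW : IsDiagram m (copairing side n) (m + 2 * n) := isDiagram_copairing side rfl
    have h4 := strandLeft_add side n n n
    rw [← two_mul] at h4
    have h5 := Iso.interchange_strandLeft side (m := m + 2 * n + 2) (i := 2 * n + 1)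
      (j := n + 1 + n) (x := n) (isDiagram_strandLeft side n n) (by omega) (by omega) (by omega)
    refine h5.step (copairing side n ++ ([⟨3 * n, .cup⟩] ++ strandLeft side (2 * n) n)) []
      (dW.append (dc.append (isDiagram_strandLeft_of_lt side (by omega)))) ?_ (by simp [h4])
    -- The last minimum passes the `n` given strands before it with both ends; what remains is the
    -- crossing of its left end with the earlier right ends.
    have h6 := Iso.cup_strandLeft_strandLeft side (m := m + 2 * n) (2 * n) n (by omega)
    rw [show 2 * n + n = 3 * n by omega] at h6
    refine h6.step (copairing side n) (strandLeft side n n) dW ?_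
    exact (Iso.copairing_succ side m n).symm.ctx [] [] (.nil _)

/-- The zigzag identity needed for $F\circ G$: each maximum of `pairing` straightens a minimum of
`unbendBase`, and the displacement which remains is undone by the unshuffle at the bottom. -/
theorem Iso.unshuffle_unbendBase_pairing (side : Bool) {m n : ℕ} (h : 2 * n ≤ m) :
    Iso m (unshuffle side 1 1 n ++ (shift n (unbendBase side n) ++ pairing side n)) [] := by
  induction n with
  | zero => exact Iso.refl _ _
  | succ n ih =>
    have dU : IsDiagram m (unshuffle side 1 1 n) m := isDiagram_unshuffle_of_le side (by omega)
    have dS : IsDiagram m (strandLeft side n n) m := isDiagram_strandLeft_of_lt side (by omega)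
    have dL0 : IsDiagram n (unbendBase side n) (3 * n) := isDiagram_unbendBase side le_rfl (by omega)
    have dL : IsDiagram m (shift (n + 1) (unbendBase side n)) (m + 2 * n) :=
      ((isDiagram_unbendBase side (m := m - (n + 1)) (n := n) (by omega) rfl).shift (n + 1)).cast
        (by omega) (by omega)
    have dc : IsDiagram (m + 2 * n) [⟨4 * n + 1, .cup⟩] (m + 2 * n + 2) := isDiagram_cup (by omega)
    have hL := (Iso.unbendBase_succ side (m := m - (n + 1)) (n := n) (by omega)).map_shift (n + 1)
    rw [Nat.add_sub_of_le (by omega)] at hL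
    refine hL.step (unshuffle side 1 1 n ++ strandLeft side n n) (pairing side (n + 1))
      (dU.append dS) ?_ (by simp [unshuffle_one_one_succ])
    simp only [shift_append, shift_cons, shift_nil, shift_strandLeft,
      show n + 1 + 3 * n = 4 * n + 1 by omega, show n + 1 + n = 2 * n + 1 by omega]
    have d4 : IsDiagram (m + 2 * n + 2) (strandLeft side (2 * n + 1) (2 * n)) (m + 2 * n + 2) :=
      isDiagram_strandLeft_of_lt side (by omega)
    refine (Iso.pairing_succ side (m := m + 2 * n + 2) (n := n) (by omega)).step
      (unshuffle side 1 1 n ++ (strandLeft side n n ++ (shift (n + 1) (unbendBase side n) ++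
        ([⟨4 * n + 1, .cup⟩] ++ strandLeft side (2 * n + 1) (2 * n))))) []
      (dU.append (dS.append (dL.append (dc.append d4)))) ?_
    have dF : IsDiagram (2 * n + 1) (flip (strandLeft side n n)) (2 * n + 1) :=
      isDiagram_flip_strandLeft_of_lt side (by omega)
    have h1 := Iso.interchange_strandLeft side (m := m + 2 * n + 2) (i := 2 * n + 1)
      (j := 2 * n + 1) (x := 2 * n) dF (by omega) (by omega) (by omega)
    refine h1.symm.step (unshuffle side 1 1 n ++ (strandLeft side n n ++
        (shift (n + 1) (unbendBase side n) ++ [⟨4 * n + 1, .cup⟩])))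
      ([⟨2 * n, .cap⟩] ++ pairing side n) (dU.append (dS.append (dL.append dc))) ?_
    have h2 := Iso.interchange_piece (m := m + 2 * n) (i := 4 * n + 1) (j := 4 * n + 1)
      (p := .cup) dF (by omega) (by simp [Piece.ins]; omega) (by omega)
    refine h2.symm.step (unshuffle side 1 1 n ++ (strandLeft side n n ++
        shift (n + 1) (unbendBase side n)))
      (strandLeft side (2 * n + 1) (2 * n) ++ ([⟨2 * n, .cap⟩] ++ pairing side n))
      (dU.append (dS.append dL)) ?_
    have h3 := Iso.zigzag_flip_strandLeft side (m := m + 2 * n) (2 * n) (2 * n) (by omega)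
    rw [show 2 * n + 1 + 2 * n = 4 * n + 1 by omega] at h3
    refine h3.step (unshuffle side 1 1 n ++ (strandLeft side n n ++
        (shift (n + 1) (unbendBase side n) ++ flip (strandLeft side n n)))) (pairing side n)
      (dU.append (dS.append (dL.append (isDiagram_flip_strandLeft_of_lt side (by omega))))) ?_
    have h4 := congrArg flip (strandLeft_add side n n (2 * n))
    rw [flip_append, ← two_mul, show n + 2 * n = 3 * n by omega] at h4
    -- The straightened strand moves right across `3 * n` strands. Pulled below the `n` earlier
    -- minima it crosses only `n`, and this is the inverse of the last step of the unshuffle.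
    have h5 := Iso.shift_append_flip_strandLeft side (m := m) n dL0 (by omega)
    refine h5.step (unshuffle side 1 1 n ++ strandLeft side n n) (pairing side n)
      (dU.append dS) ?_ (by simp [h4])
    refine (Iso.strandLeft_append_flip side n n (by omega)).step (unshuffle side 1 1 n)
      (shift n (unbendBase side n) ++ pairing side n) dU ?_
    exact (ih (by omega)).ctx [] [] (.nil _)

/-- Write $L,R$ for the inputs and $c,c'$ for the ends of the minima. Both sides arrange the strands
as $L\,c\,c'\,R$. On the right $L$ and $R$ are separated before the minima appear between them.
Since all passages are on one side, the minima can be created after the separation. -/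
theorem Iso.insertCups_unshuffle (side : Bool) {m n : ℕ} (h : 2 * n ≤ m) :
    Iso m (insertCups 2 1 n ++ (unshuffle side 2 2 n ++ (unshuffle side 1 1 n ++
      shift (2 * n) (unshuffle side 1 1 n))))
      (unshuffle side 1 1 n ++ shift n (copairing side n)) := by
  induction n with
  | zero => exact Iso.refl _ _
  | succ n ih =>
    set U := unshuffle side 1 1 n with hU
    set I := insertCups 2 1 n with hI
    set Q := unshuffle side 2 2 n with hQ
    have dI : IsDiagram m I (m + 2 * n) :=
      ((isDiagram_insertCups 2 1 n (by omega)).addRight (m - 2 * n)).cast (by omega) (by omega)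
    have dQ : ∀ {k}, 4 * n ≤ k → IsDiagram k Q k := fun h =>
      isDiagram_unshuffle_of_le side (by omega)
    have dU : ∀ {k}, 2 * n ≤ k → IsDiagram k U k := fun h =>
      isDiagram_unshuffle_of_le side (by omega)
    have dc : IsDiagram (m + 2 * n) [⟨4 * n + 1, .cup⟩] (m + 2 * n + 2) := isDiagram_cup (by omega)
    have dS : ∀ {i x}, i + x ≤ m + 2 * n + 1 →
        IsDiagram (m + 2 * n + 2) (strandLeft side i x) (m + 2 * n + 2) := fun h =>
      isDiagram_strandLeft_of_lt side (by omega)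
    have hI' : insertCups 2 1 (n + 1) = I ++ [⟨4 * n + 1, .cup⟩] := by
      simp [insertCups, hI, Nat.mul_comm]
    rw [hI', unshuffle_one_one_succ, unshuffle_two_two_succ, ← hU, ← hQ]
    simp only [shift_append, shift_strandLeft, show 2 * (n + 1) + n = 3 * n + 2 by omega]
    -- bring together the parts which belong to the first `n` groups
    have e1 := Iso.interchange_piece (m := m + 2 * n) (i := 4 * n + 1) (j := 4 * n + 1)
      (p := .cup) (dQ le_rfl) (by omega) (by simp [Piece.ins]; omega) (by omega)
    refine e1.symm.step I (strandLeft side (2 * n) (2 * n) ++ (strandLeft side (2 * n + 1) (2 * n) ++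
      (U ++ (strandLeft side n n ++ (shift (2 * (n + 1)) U ++ strandLeft side (3 * n + 2) n))))) dI
      ?_
    have e2 := Iso.interchange (m := m + 2 * n + 2) (isDiagram_strandLeft side n n)
      ((dU le_rfl).shift 1) (by omega)
    simp only [shift_shift, show n + n + 1 + 1 = 2 * (n + 1) by omega] at e2
    refine e2.step (I ++ (Q ++ ([⟨4 * n + 1, .cup⟩] ++ (strandLeft side (2 * n) (2 * n) ++
      (strandLeft side (2 * n + 1) (2 * n) ++ U))))) (strandLeft side (3 * n + 2) n)
      (dI.append ((dQ (by omega)).append (dc.append ((dS (by omega)).append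
        ((dS (by omega)).append (dU (by omega))))))) ?_
    have e3 : ∀ j, 2 * n ≤ j → j + 2 * n ≤ m + 2 * n + 1 →
        Iso (m + 2 * n + 2) (strandLeft side j (2 * n) ++ U) (U ++ strandLeft side j (2 * n)) :=
      fun j hj hj' => (Iso.interchange_strandLeft side (dU le_rfl) hj (by omega) rfl).symm
    have e4 : Iso (m + 2 * n + 2) (U ++ shift (2 * (n + 1)) U) (shift (2 * (n + 1)) U ++ U) := by
      have := Iso.interchange (m := m + 2 * n + 2) (dU le_rfl) ((dU (k := 2 * n) le_rfl).shift 2)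
        (by omega)
      simpa only [shift_shift, show 2 * n + 2 = 2 * (n + 1) by omega] using this
    refine e4.step (I ++ (Q ++ ([⟨4 * n + 1, .cup⟩] ++ (strandLeft side (2 * n) (2 * n) ++
      strandLeft side (2 * n + 1) (2 * n))))) (strandLeft side n n ++ strandLeft side (3 * n + 2) n)
      (dI.append ((dQ (by omega)).append (dc.append ((dS (by omega)).append
        (dS (by omega)))))) ?_
    have e5 := Iso.shift_append_strandLeft side (m := m + 2 * n + 2) (2 * n + 1) (dU le_rfl)
      (by omega)
    have e6 := Iso.shift_append_strandLeft side (m := m + 2 * n + 2) (2 * n) (dU le_rfl)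
      (by omega)
    refine e5.symm.step (I ++ (Q ++ ([⟨4 * n + 1, .cup⟩] ++ strandLeft side (2 * n) (2 * n))))
      (U ++ (strandLeft side n n ++ strandLeft side (3 * n + 2) n))
      (dI.append ((dQ (by omega)).append (dc.append (dS (by omega))))) ?_
      (by simp [Nat.mul_add, Nat.add_assoc])
    refine e6.symm.step (I ++ (Q ++ [⟨4 * n + 1, .cup⟩])) (strandLeft side (2 * n + 1) (2 * n) ++
      (U ++ (strandLeft side n n ++ strandLeft side (3 * n + 2) n)))
      (dI.append ((dQ (by omega)).append dc)) ?_
    have dX : ∀ {k}, 4 * n ≤ k → IsDiagram k (shift (2 * n) U) k := fun {k} h =>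
      ((dU (k := k - 2 * n) (by omega)).shift (2 * n)).cast (by omega) (by omega)
    have e7 := Iso.interchange_piece (m := m + 2 * n) (i := 4 * n + 1) (j := 4 * n + 1)
      (p := .cup) (dX le_rfl) (by omega) (by simp [Piece.ins]; omega) (by omega)
    refine e7.symm.step (I ++ Q) (strandLeft side (2 * n) (2 * n) ++
      (strandLeft side (2 * n + 1) (2 * n) ++
      (U ++ (strandLeft side n n ++ strandLeft side (3 * n + 2) n))))
      (dI.append (dQ (by omega))) ?_
    refine (e3 (2 * n + 1) (by omega) (by omega)).step (I ++ (Q ++ (shift (2 * n) U ++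
      ([⟨4 * n + 1, .cup⟩] ++ strandLeft side (2 * n) (2 * n)))))
      (strandLeft side n n ++ strandLeft side (3 * n + 2) n)
      (dI.append ((dQ (by omega)).append ((dX (by omega)).append
        (dc.append (dS (by omega)))))) ?_
    refine (e3 (2 * n) (by omega) (by omega)).step (I ++ (Q ++ (shift (2 * n) U ++
      [⟨4 * n + 1, .cup⟩]))) (strandLeft side (2 * n + 1) (2 * n) ++
      (strandLeft side n n ++ strandLeft side (3 * n + 2) n))
      (dI.append ((dQ (by omega)).append ((dX (by omega)).append dc))) ?_
    have e8 := Iso.interchange_piece (m := m + 2 * n) (i := 4 * n + 1) (j := 4 * n + 1)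
      (p := .cup) (dU le_rfl) (by omega) (by simp [Piece.ins]; omega) (by omega)
    refine e8.symm.step (I ++ (Q ++ shift (2 * n) U)) (strandLeft side (2 * n) (2 * n) ++
      (strandLeft side (2 * n + 1) (2 * n) ++
      (strandLeft side n n ++ strandLeft side (3 * n + 2) n)))
      (dI.append ((dQ (by omega)).append (dX (by omega)))) ?_
    have e9 := Iso.interchange (m := m + 2 * n) (dU le_rfl) (dU (k := 2 * n) le_rfl) (by omega)
    refine e9.symm.step (I ++ Q) ([⟨4 * n + 1, .cup⟩] ++ (strandLeft side (2 * n) (2 * n) ++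
      (strandLeft side (2 * n + 1) (2 * n) ++
      (strandLeft side n n ++ strandLeft side (3 * n + 2) n))))
      (dI.append (dQ (by omega))) ?_
    refine (ih (by omega)).step [] ([⟨4 * n + 1, .cup⟩] ++ (strandLeft side (2 * n) (2 * n) ++
      (strandLeft side (2 * n + 1) (2 * n) ++
      (strandLeft side n n ++ strandLeft side (3 * n + 2) n)))) (.nil _) ?_
    -- the last group
    have dW0 : IsDiagram 0 (copairing side n) (2 * n) := isDiagram_copairing side (by omega)
    have dW : IsDiagram m (shift n (copairing side n)) (m + 2 * n) :=
      ((isDiagram_copairing side (m := m - n) rfl).shift n).cast (by omega) (by omega)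
    have dUW := (dU (k := m) (by omega)).append dW
    have f1 := Iso.interchange_strandLeft side (m := m + 2 * n + 2) (i := 3 * n + 2)
      (j := 3 * n + 2) (x := n) (isDiagram_strandLeft side n n) (by omega) (by omega) rfl
    refine f1.step (U ++ (shift n (copairing side n) ++ ([⟨4 * n + 1, .cup⟩] ++
      (strandLeft side (2 * n) (2 * n) ++ strandLeft side (2 * n + 1) (2 * n))))) []
      ((dU (by omega)).append (dW.append (dc.append ((dS (by omega)).append (dS (by omega)))))) ?_
    -- The last $c$ crosses first all earlier $R$ and then all earlier $c'$. The first half is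
    -- matched with the passage of the last $c'$ across the same $R$, so the whole minimum moves
    -- from `4 * n + 1` to `3 * n + 1`.
    have g1 : strandLeft side (2 * n + 1) (2 * n) =
        strandLeft side (3 * n + 1) n ++ strandLeft side (2 * n + 1) n := by
      rw [two_mul, strandLeft_add]; congr 2; omega
    have f2 := Iso.interchange_strandLeft side (m := m + 2 * n + 2) (i := 3 * n + 2)
      (j := 3 * n + 2) (x := n) (isDiagram_strandLeft side (2 * n + 1) n) (by omega) (by omega) rfl
    refine f2.step (U ++ (shift n (copairing side n) ++ ([⟨4 * n + 1, .cup⟩] ++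
      (strandLeft side (2 * n) (2 * n) ++ strandLeft side (3 * n + 1) n)))) (strandLeft side n n)
      ((dU (by omega)).append (dW.append (dc.append ((dS (by omega)).append (dS (by omega))))))
      ?_ (by simp [g1])
    have f3 := Iso.interchange_piece (m := m + 2 * n) (i := 4 * n + 1) (j := 4 * n + 1)
      (p := .cup) (isDiagram_strandLeft side (2 * n) (2 * n)) (by omega)
      (by simp [Piece.ins]; omega) (by omega)
    refine f3.symm.step (U ++ shift n (copairing side n)) (strandLeft side (3 * n + 1) n ++
      (strandLeft side (3 * n + 2) n ++ (strandLeft side (2 * n + 1) n ++ strandLeft side n n)))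
      ((dU (by omega)).append dW) ?_
    have dS' : ∀ {i x}, i + x < m + 2 * n →
        IsDiagram (m + 2 * n) (strandLeft side i x) (m + 2 * n) := fun h =>
      isDiagram_strandLeft_of_lt side (by omega)
    have f4 := Iso.cup_strandLeft_strandLeft side (m := m + 2 * n) (3 * n + 1) n (by omega)
    rw [show 3 * n + 1 + n = 4 * n + 1 by omega] at f4
    refine f4.step (U ++ (shift n (copairing side n) ++ strandLeft side (2 * n) (2 * n)))
      (strandLeft side (2 * n + 1) n ++ strandLeft side n n)
      ((dU (by omega)).append (dW.append (dS' (by omega)))) ?_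
    have f5 := Iso.interchange_strandLeft side (m := m + 2 * n + 2) (i := 2 * n + 1)
      (j := 2 * n + 1) (x := n) (isDiagram_strandLeft side n n) (by omega) (by omega) rfl
    refine f5.symm.step (U ++ (shift n (copairing side n) ++ (strandLeft side (2 * n) (2 * n) ++
      [⟨3 * n + 1, .cup⟩]))) []
      ((dU (by omega)).append (dW.append ((dS' (by omega)).append (isDiagram_cup (by omega))))) ?_
    have f6 := Iso.interchange_piece (m := m + 2 * n) (i := 3 * n + 1) (j := 3 * n + 1)
      (p := .cup) (isDiagram_strandLeft side n n) (by omega)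
      (by simp [Piece.ins]; omega) (by omega)
    refine f6.symm.step (U ++ (shift n (copairing side n) ++ strandLeft side (2 * n) (2 * n)))
      (strandLeft side (2 * n + 1) n)
      ((dU (by omega)).append (dW.append (dS' (by omega)))) ?_
    have g2 := strandLeft_add side n n (2 * n)
    rw [← two_mul] at g2
    -- The last $L$ crosses the earlier $R$, $c'$ and $c$ in one passage. Pulled below the earlier
    -- minima it meets only the $R$, which is the last step of the unshuffle of $L$ and $R$.
    have f7 := Iso.shift_append_strandLeft side (m := m) n
      (isDiagram_copairing side (m := n) (n := n) (k := 3 * n) (by omega)) (by omega)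
    rw [show 3 * n = n + 2 * n by omega] at f7
    refine f7.step U ([⟨3 * n + 1, .cup⟩] ++ strandLeft side (2 * n + 1) n)
      (dU (by omega)) ?_ (by simp [g2])
    have f8 := (Iso.copairing_succ side (m - (n + 1)) n).map_shift (n + 1)
    rw [Nat.add_sub_of_le (by omega)] at f8
    exact f8.symm.ctx (U ++ strandLeft side n n) []
      ((dU (by omega)).append (isDiagram_strandLeft_of_lt side (by omega)))
      (by simp [shift_strandLeft, show n + 1 + 2 * n = 3 * n + 1 by omega,
        show n + 1 + n = 2 * n + 1 by omega]) (by simp)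

/-- Each of the last `n` first strands crosses the second strands of its own family and then the `m`
of the other family. The crossings of the second kind are postponed and collected in a block. -/
theorem Iso.unshuffle_add (side : Bool) (m n : ℕ) :
    Iso (2 * m + 2 * n) (unshuffle side 1 1 (m + n))
      (unshuffle side 1 1 m ++ (shift (2 * m) (unshuffle side 1 1 n) ++ block side m m n)) := by
  induction n with
  | zero => simpa [block, unshuffle] using Iso.refl _ _
  | succ n ih =>
    rw [← Nat.add_assoc, unshuffle_one_one_succ, unshuffle_one_one_succ]
    refine (ih.mono (by omega)).step [] (strandLeft side (m + n) (m + n)) (.nil _) ?_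
    have dU : IsDiagram (2 * m + 2 * (n + 1)) (unshuffle side 1 1 m) (2 * m + 2 * (n + 1)) :=
      isDiagram_unshuffle_of_le side (by omega)
    have dU' : IsDiagram (2 * m + 2 * (n + 1)) (shift (2 * m) (unshuffle side 1 1 n))
        (2 * m + 2 * (n + 1)) := (isDiagram_unshuffle_of_le side (by omega)).shift (2 * m)
    have h1 := Iso.interchange_strandLeft side (m := 2 * m + 2 * (n + 1)) (i := 2 * m + n)
      (j := 2 * m + n) (x := n) (isDiagram_block side m m n) (by omega) (by omega) rfl
    have g : strandLeft side (m + n) (m + n) =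
        strandLeft side (2 * m + n) n ++ strandLeft side (m + n) m := by
      rw [strandLeft_add]; congr 2; omega
    exact h1.ctx (unshuffle side 1 1 m ++ shift (2 * m) (unshuffle side 1 1 n))
      (strandLeft side (m + n) m) (dU.append dU') (by simp [g])
      (by simp [block, shift_strandLeft])


/-! ### The operations on string links and handles up to isotopy -/

theorem bendWord_eq (side : Bool) (n : ℕ) (S : Word) :
    bendWord side n S = unshuffle side 1 1 n ++ (shift n S ++ pairing side n) := by
  simp [bendWord, pairing]

theorem unbendWord_eq (side : Bool) (n : ℕ) (T : Word) :
    unbendWord side n T = unbendBase side n ++ shift n T := rfl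

/-- Once the lower arcs are a `copairing`, `S` slides down to the right of them and the zigzag
identity removes all arcs. -/
theorem Iso.unbend_bend (side : Bool) {n : ℕ} {S : Word} (hS : IsDiagram n S n) :
    Iso n (unbendWord side n (bendWord side n S)) S := by
  refine (Iso.unbendBase_unshuffle side le_rfl).step [] (shift (n + n) S ++
    shift n (pairing side n)) (.nil _) ?_ (by simp [unbendWord_eq, bendWord_eq])
  have h1 := Iso.interchange (m := n) (isDiagram_copairing side (m := 0) (n := n) rfl) hS (by omega)
  rw [shift_zero, show 0 + 2 * n = n + n by omega] at h1
  refine h1.step [] (shift n (pairing side n)) (.nil _) ?_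
  exact (Iso.copairing_pairing side le_rfl).ctx S [] hS

/-- `T` stands to the right of the strands that `pairing` closes, so it can be raised above them;
the arcs then cancel below `T`. -/
theorem Iso.bend_unbend (side : Bool) {n : ℕ} {T : Word} (hT : IsDiagram (2 * n) T 0) :
    Iso (2 * n) (bendWord side n (unbendWord side n T)) T := by
  have dU : IsDiagram (2 * n) (unshuffle side 1 1 n) (2 * n) :=
    isDiagram_unshuffle_of_le side (by omega)
  have dL : IsDiagram (2 * n) (shift n (unbendBase side n)) (2 * n + 2 * n) :=
    ((isDiagram_unbendBase side (m := n) le_rfl rfl).shift n).cast (by omega) (by omega)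
  have h1 := Iso.interchange (m := 2 * n + 2 * n)
    (isDiagram_pairing side (m := 2 * n) (k := 0) (n := n) (by omega)) hT le_rfl
  rw [shift_zero, two_mul] at h1
  rw [bendWord_eq, unbendWord_eq]
  refine h1.symm.step (unshuffle side 1 1 n ++ shift n (unbendBase side n)) [] ?_ ?_
  · exact (dU.append dL).cast rfl (by omega)
  exact (Iso.unshuffle_unbendBase_pairing side le_rfl).ctx [] T (.nil _)

theorem Iso.bend_nil (side : Bool) (n : ℕ) : Iso (2 * n) (bendWord side n []) (caps n) := by
  have dU : IsDiagram (2 * n) (unshuffle side 1 1 n) (2 * n) :=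
    isDiagram_unshuffle_of_le side (by omega)
  exact (Iso.append_flip (unshuffle_cross side 1 1 n) dU).ctx [] (caps n) (.nil _)
    (by simp [bendWord])

/-- After the regrouping, `S` sits on $R$ and slides below the minima. The maxima of $F(S)$
straighten them, so that $R$, after `S`, continues in $c$, where it meets `S'` and the maxima of
$F(S')$. -/
theorem Iso.bend_append (side : Bool) {n : ℕ} {S S' : Word} (hS : IsDiagram n S n)
    (hS' : IsDiagram n S' n) :
    Iso (2 * n) (handleCompWord side n (bendWord side n S') (bendWord side n S))
      (bendWord side n (S ++ S')) := by
  have dI : IsDiagram (2 * n) (insertCups 2 1 n) (2 * n + 2 * n) :=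
    (isDiagram_insertCups 2 1 n (by omega)).cast (by omega) (by omega)
  have dQ : IsDiagram (2 * n + 2 * n) (unshuffle side 2 2 n) (2 * n + 2 * n) :=
    isDiagram_unshuffle_of_le side (by omega)
  have dU : ∀ {k}, 2 * n ≤ k → IsDiagram k (unshuffle side 1 1 n) k := fun h =>
    isDiagram_unshuffle_of_le side (by omega)
  have dS : IsDiagram (2 * n) (shift n S') (2 * n) := (hS'.shift n).cast (by omega) (by omega)
  have h1 := Iso.interchange (m := 2 * n + 2 * n)
    (dS.append (isDiagram_pairing side (m := 2 * n) (k := 0) (n := n) (by omega)))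
    (isDiagram_bendWord side n hS) le_rfl
  rw [shift_zero] at h1
  refine h1.step (insertCups 2 1 n ++ (unshuffle side 2 2 n ++ unshuffle side 1 1 n)) []
    (dI.append (dQ.append (dU (by omega)))) ?_ (by simp [handleCompWord, bendWord_eq side n S'])
  simp only [bendWord_eq, shift_append, shift_shift]
  refine (Iso.insertCups_unshuffle side le_rfl).step [] (shift (2 * n + n) S ++
    (shift (2 * n) (pairing side n) ++ (shift n S' ++ pairing side n))) (.nil _) ?_
  have h2 := (Iso.interchange (m := n) (isDiagram_copairing side (m := 0) (n := n) rfl) hS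
    (by omega)).map_shift n
  simp only [shift_append, shift_shift, ← two_mul, Nat.add_zero, Nat.zero_add,
    show n + 2 * n = 2 * n + n by omega] at h2
  refine h2.step (unshuffle side 1 1 n) (shift (2 * n) (pairing side n) ++
    (shift n S' ++ pairing side n)) (dU le_rfl) ?_
  have h3 := (Iso.copairing_pairing side (m := n) le_rfl).map_shift n
  simp only [shift_append, shift_shift, ← two_mul, shift_nil] at h3
  exact h3.ctx (unshuffle side 1 1 n ++ shift n S) (shift n S' ++ pairing side n)
    ((dU le_rfl).append ((hS.shift n).cast (by omega) (by omega)))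

/-- The crossings between the two families form one block below the string links and its inverse
above them. The block passes through `S` by naturality and past `S'` because they are side by side;
then it cancels. -/
theorem Iso.bend_tensor (side : Bool) {m n : ℕ} {S S' : Word} (hS : IsDiagram m S m)
    (hS' : IsDiagram n S' n) :
    Iso (2 * (m + n)) (bendWord side (m + n) (S ++ shift m S'))
      (bendWord side m S ++ bendWord side n S') := by
  have hk : 2 * (m + n) = 2 * m + 2 * n := by omega
  rw [hk]
  have dU : IsDiagram (2 * m) (unshuffle side 1 1 m) (2 * m) :=
    isDiagram_unshuffle_of_le side (by omega)
  have dU' : IsDiagram (2 * n) (unshuffle side 1 1 n) (2 * n) :=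
    isDiagram_unshuffle_of_le side (by omega)
  have dUU : IsDiagram (2 * m + 2 * n) (unshuffle side 1 1 (m + n)) (2 * m + 2 * n) :=
    isDiagram_unshuffle_of_le side (by omega)
  have dB : IsDiagram (2 * m + n) (block side m m n) (2 * m + n) :=
    isDiagram_block_of_le side (by omega)
  have dS : IsDiagram (2 * m) (shift m S) (2 * m) := (hS.shift m).cast (by omega) (by omega)
  have dS' : IsDiagram (2 * n) (shift n S') (2 * n) := (hS'.shift n).cast (by omega) (by omega)
  have dm : ∀ {w}, IsDiagram (2 * m) w (2 * m) → IsDiagram (2 * m + 2 * n) w (2 * m + 2 * n) :=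
    fun h => h.mono (by omega)
  have dSS : IsDiagram (2 * m + 2 * n) (shift (m + n) S) (2 * m + 2 * n) :=
    ((hS.shift (m + n)).addRight n).cast (by omega) (by omega)
  have dSS' : IsDiagram (2 * m + 2 * n) (shift (m + n + m) S') (2 * m + 2 * n) :=
    (hS'.shift (m + n + m)).cast (by omega) (by omega)
  have hc : caps (m + n) = caps m ++ caps n := by simp [caps]
  have h0 := Iso.unshuffle_add side m n
  refine h0.step [] (shift (m + n) S ++ (shift (m + n + m) S' ++ pairing side (m + n)))
    (.nil _) ?_ (by simp [bendWord_eq])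
  refine (h0.map_flip dUU).step (unshuffle side 1 1 m ++ (shift (2 * m) (unshuffle side 1 1 n) ++
    (block side m m n ++ (shift (m + n) S ++ shift (m + n + m) S')))) (caps m ++ caps n)
    ((dm dU).append ((dU'.shift (2 * m)).append ((dB.mono (by omega)).append
      (dSS.append dSS')))) ?_ (by simp [pairing, hc])
  simp only [RibbonTangle.flip_append, flip_shift]
  refine (Iso.shift_append_block side m n hS (by omega)).symm.step
    (unshuffle side 1 1 m ++ shift (2 * m) (unshuffle side 1 1 n))
    (shift (m + n + m) S' ++ (flip (block side m m n) ++ (shift (2 * m)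
      (flip (unshuffle side 1 1 n)) ++ (flip (unshuffle side 1 1 m) ++ (caps m ++ caps n)))))
    ((dm dU).append (dU'.shift (2 * m))) ?_
  have h1 := Iso.interchange (m := 2 * m + 2 * n) dB hS' (by omega)
  rw [show 2 * m + n = m + n + m by omega] at h1
  refine h1.step (unshuffle side 1 1 m ++ (shift (2 * m) (unshuffle side 1 1 n) ++ shift m S))
    (flip (block side m m n) ++ (shift (2 * m)
      (flip (unshuffle side 1 1 n)) ++ (flip (unshuffle side 1 1 m) ++ (caps m ++ caps n))))
    ((dm dU).append ((dU'.shift (2 * m)).append (dm dS))) ?_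
  refine ((Iso.append_flip (block_cross side m m n) dB).mono (by omega)).step
    (unshuffle side 1 1 m ++ (shift (2 * m) (unshuffle side 1 1 n) ++ (shift m S ++
      shift (m + n + m) S'))) (shift (2 * m) (flip (unshuffle side 1 1 n)) ++
      (flip (unshuffle side 1 1 m) ++ (caps m ++ caps n)))
    ((dm dU).append ((dU'.shift (2 * m)).append ((dm dS).append dSS'))) ?_
  refine (Iso.interchange (m := 2 * m + 2 * n) dS dU' le_rfl).symm.step (unshuffle side 1 1 m)
    (shift (m + n + m) S' ++ (shift (2 * m) (flip (unshuffle side 1 1 n)) ++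
      (flip (unshuffle side 1 1 m) ++ (caps m ++ caps n)))) (dm dU) ?_
  have h2 := Iso.interchange (m := 2 * m + 2 * n)
    (isDiagram_pairing side (m := 2 * m) (k := 0) (n := m) (by omega))
    (dU'.append (dS'.append dU'.flip)) le_rfl
  simp only [shift_append, shift_shift, shift_zero, show 2 * m + n = m + n + m by omega] at h2
  exact h2.symm.ctx (unshuffle side 1 1 m ++ shift m S) (caps n) ((dm dU).append (dm dS))
    (by simp [pairing]) (by simp [bendWord_eq, pairing])

/-! ### The category of string links -/

/-- Juxtaposition is strictly associative and unital on words; only the number of strands is written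
differently. Comparing words thus gives the heterogeneous equalities. -/
theorem RSL.heq {a b : ℕ} (h : a = b) {x : RSL a} {y : RSL b} (D : Diagram a a) (E : Diagram b b)
    (hx : Quot.mk _ D = x.1) (hy : Quot.mk _ E = y.1) (hDE : D.1 = E.1) : HEq x y := by
  subst h
  obtain rfl : D = E := Subtype.ext hDE
  exact heq_of_eq (Subtype.ext (hx.symm.trans hy))

theorem RSL.ext_of_iso {n : ℕ} {x y : RSL n} (D E : Diagram n n) (hx : Quot.mk _ D = x.1)
    (hy : Quot.mk _ E = y.1) (h : Iso n D.1 E.1) : x = y :=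
  Subtype.ext (hx.symm.trans ((h.mk_eq D.2 E.2).trans hy))

theorem RHand.ext_of_iso {side : Bool} {n : ℕ} {x y : RHand side n} (D E : Diagram (2 * n) 0)
    (hx : Quot.mk _ D = x.1) (hy : Quot.mk _ E = y.1) (h : Iso (2 * n) D.1 E.1) : x = y :=
  Subtype.ext (hx.symm.trans ((h.mk_eq D.2 E.2).trans hy))

theorem Diagram.isDiagram_tensor {m n : ℕ} (D : Diagram m m) (E : Diagram n n) :
    IsDiagram (m + n) (D.1 ++ shift m E.1) (m + n) :=
  (D.2.addRight n).append (E.2.shift m)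

theorem lawfulEndoOps_RSL : LawfulEndoOps RSL where
  id_comp := by
    rintro n ⟨_, D, hD, rfl⟩
    exact RSL.ext_of_iso ⟨D.1 ++ [], D.2.append (.nil n)⟩ D rfl rfl (.of_eq (by simp))
  comp_id := by
    rintro n ⟨_, D, hD, rfl⟩
    exact RSL.ext_of_iso ⟨[] ++ D.1, D.2⟩ D rfl rfl (.of_eq (by simp))
  assoc := by
    rintro n ⟨_, D, hD, rfl⟩ ⟨_, E, hE, rfl⟩ ⟨_, K, hK, rfl⟩
    exact RSL.ext_of_iso ⟨K.1 ++ (E.1 ++ D.1), K.2.append (E.2.append D.2)⟩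
      ⟨(K.1 ++ E.1) ++ D.1, (K.2.append E.2).append D.2⟩ rfl rfl (.of_eq (by simp))
  tensor_id m n := RSL.ext_of_iso ⟨[] ++ shift m [], .nil _⟩ ⟨[], .nil _⟩ rfl rfl (.refl _ _)
  tensor_comp := by
    rintro m n ⟨_, D, hD, rfl⟩ ⟨_, E, hE, rfl⟩ ⟨_, D', hD', rfl⟩ ⟨_, E', hE', rfl⟩
    refine RSL.ext_of_iso
      ⟨(E.1 ++ D.1) ++ shift m (E'.1 ++ D'.1),
        ((E.2.append D.2).addRight n).append ((E'.2.append D'.2).shift m)⟩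
      ⟨(E.1 ++ shift m E'.1) ++ (D.1 ++ shift m D'.1),
        (E.isDiagram_tensor E').append (D.isDiagram_tensor D')⟩ rfl rfl ?_
    -- The only law for string links that needs an isotopy; the others are equalities of words.
    exact (Iso.interchange D.2 E'.2 le_rfl).ctx E.1 (shift m D'.1) (E.2.addRight n)
  tensor_assoc := by
    rintro m n k ⟨_, D, hD, rfl⟩ ⟨_, E, hE, rfl⟩ ⟨_, K, hK, rfl⟩
    exact RSL.heq (Nat.add_assoc m n k)
      ⟨(D.1 ++ shift m E.1) ++ shift (m + n) K.1,
        Diagram.isDiagram_tensor ⟨_, D.isDiagram_tensor E⟩ K⟩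
      ⟨D.1 ++ shift m (E.1 ++ shift n K.1),
        Diagram.isDiagram_tensor D ⟨_, E.isDiagram_tensor K⟩⟩ rfl rfl (by simp)
  id_tensor := by
    rintro n ⟨_, D, hD, rfl⟩
    exact RSL.heq (Nat.zero_add n) ⟨[] ++ shift 0 D.1, Diagram.isDiagram_tensor ⟨[], .nil 0⟩ D⟩ D
      rfl rfl (by simp)
  tensor_id_zero := by
    rintro n ⟨_, D, hD, rfl⟩
    exact RSL.heq (Nat.add_zero n) ⟨D.1 ++ shift n [], Diagram.isDiagram_tensor D ⟨[], .nil 0⟩⟩ D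
      rfl rfl (by simp)

/-! ### The bijection between string links and handles -/

theorem toStringLink_toHandle (side : Bool) (n : ℕ) (S : RSL n) :
    toStringLink side n (toHandle side n S) = S := by
  obtain ⟨_, D, hD, rfl⟩ := S
  exact RSL.ext_of_iso ⟨_, isDiagram_unbendWord side n (isDiagram_bendWord side n D.2)⟩ D rfl rfl
    (Iso.unbend_bend side D.2)

theorem toHandle_toStringLink (side : Bool) (n : ℕ) (T : RHand side n) :
    toHandle side n (toStringLink side n T) = T := by
  obtain ⟨_, D, hD, rfl⟩ := T
  exact RHand.ext_of_iso ⟨_, isDiagram_bendWord side n (isDiagram_unbendWord side n D.2)⟩ D rfl rfl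
    (Iso.bend_unbend side D.2)

theorem isFunctorial_toHandle (side : Bool) : EndoCat.IsFunctorial (toHandle side) where
  map_id n := RHand.ext_of_iso ⟨_, isDiagram_bendWord side n (.nil n)⟩ ⟨_, isDiagram_caps n⟩ rfl rfl
    (Iso.bend_nil side n)
  map_comp := by
    rintro n ⟨_, D, hD, rfl⟩ ⟨_, E, hE, rfl⟩
    exact RHand.ext_of_iso ⟨_, isDiagram_bendWord side n (E.2.append D.2)⟩
      ⟨_, isDiagram_handleCompWord side n (isDiagram_bendWord side n D.2)
        (isDiagram_bendWord side n E.2)⟩ rfl rfl (Iso.bend_append side E.2 D.2).symm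

theorem toHandle_tensor (side : Bool) {m n : ℕ} (x : RSL m) (y : RSL n) :
    toHandle side (m + n) (EndoOps.tensor x y) =
      EndoOps.tensor (toHandle side m x) (toHandle side n y) := by
  obtain ⟨_, D, hD, rfl⟩ := x
  obtain ⟨_, E, hE, rfl⟩ := y
  have h := Iso.bend_tensor side D.2 E.2
  refine RHand.ext_of_iso ⟨_, isDiagram_bendWord side (m + n) (D.isDiagram_tensor E)⟩
    ⟨bendWord side m D.1 ++ shift 0 (bendWord side n E.1), ?_⟩ rfl rfl (by simpa using h)
  simpa using h.isDiagram_iff.1 (isDiagram_bendWord side (m + n) (D.isDiagram_tensor E))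

/-! ### Transport of structure -/

section Transport

/-- The endomorphisms are arbitrary with a proof that they are identities, so that structure
morphisms which are identities only after unfolding can be supplied. -/
theorem comp_comp_of_eq_id {C : Type} [Category.{0} C] {A B : C} {e e' : A ⟶ A} (h : e = 𝟙 A)
    (h' : e' = 𝟙 A) (g : A ⟶ B) : e ≫ e' ≫ g = g := by
  simp [h, h']

theorem comp_of_eq_id {C : Type} [Category.{0} C] {A B : C} {e e' : B ⟶ B} (h : e = 𝟙 B)
    (h' : e' = 𝟙 B) (g : A ⟶ B) : g ≫ e ≫ e' = g := by
  simp [h, h']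

variable {M N : ℕ → Type} [EndoOps M] [EndoOps N]

/-- The axioms of a strict monoidal category are transported along a bijection. -/
theorem LawfulEndoOps.of_equiv (hM : LawfulEndoOps M) {f : ∀ n, M n → N n} {g : ∀ n, N n → M n}
    (hf : EndoCat.IsFunctorial f)
    (ht : ∀ {m n : ℕ} (x : M m) (y : M n),
      f (m + n) (EndoOps.tensor x y) = EndoOps.tensor (f m x) (f n y))
    (hfg : ∀ n y, f n (g n y) = y) : LawfulEndoOps N := by
  have hs : ∀ {n : ℕ} (y : N n), ∃ x, f n x = y := fun {n} y => ⟨g n y, hfg n y⟩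
  -- The associativity and unit laws of juxtaposition compare elements over different indices, so
  -- `f` must be seen to respect heterogeneous equality.
  have hh : ∀ {a b : ℕ} (_ : a = b) {x : M a} {y : M b}, HEq x y → HEq (f a x) (f b y) := by
    rintro a b rfl x y h
    rw [eq_of_heq h]
  constructor
  · intro n y
    obtain ⟨x, rfl⟩ := hs y
    rw [← hf.map_id, ← hf.map_comp, hM.id_comp]
  · intro n y
    obtain ⟨x, rfl⟩ := hs y
    rw [← hf.map_id, ← hf.map_comp, hM.comp_id]
  · intro n a b c
    obtain ⟨a, rfl⟩ := hs a
    obtain ⟨b, rfl⟩ := hs b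
    obtain ⟨c, rfl⟩ := hs c
    simp only [← hf.map_comp, hM.assoc]
  · intro m n
    rw [← hf.map_id, ← hf.map_id, ← hf.map_id, ← ht, hM.tensor_id]
  · intro m n a b a' b'
    obtain ⟨a, rfl⟩ := hs a
    obtain ⟨b, rfl⟩ := hs b
    obtain ⟨a', rfl⟩ := hs a'
    obtain ⟨b', rfl⟩ := hs b'
    simp only [← hf.map_comp, ← ht, hM.tensor_comp]
  · intro m n k a b c
    obtain ⟨a, rfl⟩ := hs a
    obtain ⟨b, rfl⟩ := hs b
    obtain ⟨c, rfl⟩ := hs c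
    simp only [← ht]
    exact hh (Nat.add_assoc m n k) (hM.tensor_assoc a b c)
  · intro n a
    obtain ⟨a, rfl⟩ := hs a
    rw [← hf.map_id, ← ht]
    exact hh (Nat.zero_add n) (hM.id_tensor a)
  · intro n a
    obtain ⟨a, rfl⟩ := hs a
    rw [← hf.map_id, ← ht]
    exact hh (Nat.add_zero n) (hM.tensor_id_zero a)

theorem EndoCat.IsFunctorial.inverse {f : ∀ n, M n → N n} {g : ∀ n, N n → M n}
    (hf : EndoCat.IsFunctorial f) (hgf : ∀ n x, g n (f n x) = x)
    (hfg : ∀ n y, f n (g n y) = y) : EndoCat.IsFunctorial g where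
  map_id n := by rw [← hf.map_id, hgf]
  map_comp {n} x y := by
    conv_lhs => rw [← hfg n x, ← hfg n y, ← hf.map_comp, hgf]

variable [LawfulEndoOps M] [LawfulEndoOps N]

/-- The functor fixes the underlying integers, so the tensorator and the unit comparison can be
identities. Naturality is then compatibility with juxtaposition, and coherence says that the functor
sends each `eqToHom` to the corresponding `eqToHom`. -/
theorem EndoCat.isStrictMonoidal_functor {f : ∀ n, M n → N n} (hf : EndoCat.IsFunctorial f)
    (ht : ∀ {m n : ℕ} (x : M m) (y : M n),
      f (m + n) (EndoOps.tensor x y) = EndoOps.tensor (f m x) (f n y)) :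
    IsStrictMonoidal (EndoCat.functor f hf) := by
  have hmap : ∀ {X Y X' Y' : EndoCat M} (a : X ⟶ Y) (b : X' ⟶ Y'),
      (EndoCat.functor f hf).map (a ⊗ₘ b) =
        ((EndoCat.functor f hf).map a ⊗ₘ (EndoCat.functor f hf).map b :) := by
    rintro _ _ _ _ ⟨a⟩ ⟨b⟩
    exact congrArg Hom.of (ht a b)
  have hα : ∀ {X Y : EndoCat M} (h : X = Y), (EndoCat.functor f hf).map (eqToHom h) =
      eqToHom (congrArg (EndoCat.functor f hf).obj h) := fun h => eqToHom_map _ h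
  let core : (EndoCat.functor f hf).CoreMonoidal :=
    { εIso := CategoryTheory.Iso.refl (⟨0⟩ : EndoCat N)
      μIso := fun X Y => CategoryTheory.Iso.refl (⟨X.n + Y.n⟩ : EndoCat N)
      μIso_hom_natural_left := fun {X Y} a Z => by
        have h := hmap a (𝟙 Z)
        rw [CategoryTheory.Functor.map_id] at h
        exact (Category.comp_id _).trans (h.symm.trans (Category.id_comp _).symm)
      μIso_hom_natural_right := fun {X Y} Z a => by
        have h := hmap (𝟙 Z) a
        rw [CategoryTheory.Functor.map_id] at h
        exact (Category.comp_id _).trans (h.symm.trans (Category.id_comp _).symm)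
      associativity := fun X Y Z =>
        (comp_comp_of_eq_id (id_whiskerRight (⟨X.n + Y.n⟩ : EndoCat N) ⟨Z.n⟩) rfl _).trans
          ((hα (EndoCat.ext (Nat.add_assoc X.n Y.n Z.n))).trans
            (comp_of_eq_id (whiskerLeft_id (⟨X.n⟩ : EndoCat N) ⟨Y.n + Z.n⟩) rfl _).symm)
      left_unitality := fun X =>
        ((comp_comp_of_eq_id (id_whiskerRight (⟨0⟩ : EndoCat N) ⟨X.n⟩) rfl _).trans
          (hα (EndoCat.ext (Nat.zero_add X.n)))).symm
      right_unitality := fun X =>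
        ((comp_comp_of_eq_id (whiskerLeft_id (⟨X.n⟩ : EndoCat N) ⟨0⟩) rfl _).trans
          (hα (EndoCat.ext (Nat.add_zero X.n)))).symm }
  exact ⟨core.toMonoidal, ⟨rfl, rfl⟩, fun X Y => ⟨rfl, rfl⟩⟩

theorem EndoCat.functor_comp_functor {f : ∀ n, M n → N n} {g : ∀ n, N n → M n}
    (hf : EndoCat.IsFunctorial f) (hg : EndoCat.IsFunctorial g) (hgf : ∀ n x, g n (f n x) = x) :
    EndoCat.functor f hf ⋙ EndoCat.functor g hg = 𝟭 (EndoCat M) := by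
  refine CategoryTheory.Functor.ext (fun X => rfl) ?_
  rintro _ _ ⟨x⟩
  have h : 𝟙 _ ≫ EndoCat.hom x ≫ 𝟙 _ = EndoCat.hom x := by simp
  exact (congrArg Hom.of (hgf _ x)).trans h.symm

end Transport

end RibbonTangle

theorem proposition2p1 (side : Bool) :
    ∃ (_ : RibbonTangle.LawfulEndoOps RibbonTangle.RSL)
      (_ : RibbonTangle.LawfulEndoOps (RibbonTangle.RHand side))
      (hF : RibbonTangle.EndoCat.IsFunctorial (RibbonTangle.toHandle side))
      (hG : RibbonTangle.EndoCat.IsFunctorial (RibbonTangle.toStringLink side)),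
      RibbonTangle.IsStrictMonoidal (RibbonTangle.EndoCat.functor (RibbonTangle.toHandle side) hF) ∧
      RibbonTangle.IsStrictMonoidal
        (RibbonTangle.EndoCat.functor (RibbonTangle.toStringLink side) hG) ∧
      RibbonTangle.EndoCat.functor (RibbonTangle.toHandle side) hF ⋙
        RibbonTangle.EndoCat.functor (RibbonTangle.toStringLink side) hG =
          𝟭 (RibbonTangle.EndoCat RibbonTangle.RSL) ∧
      RibbonTangle.EndoCat.functor (RibbonTangle.toStringLink side) hG ⋙
        RibbonTangle.EndoCat.functor (RibbonTangle.toHandle side) hF =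
          𝟭 (RibbonTangle.EndoCat (RibbonTangle.RHand side)) := by
  have hF := RibbonTangle.isFunctorial_toHandle side
  have hGF := RibbonTangle.toStringLink_toHandle side
  have hFG := RibbonTangle.toHandle_toStringLink side
  have hG := hF.inverse hGF hFG
  have hM := RibbonTangle.lawfulEndoOps_RSL
  -- The laws for handles come from those for string links through the bijection.
  have hN := hM.of_equiv hF (RibbonTangle.toHandle_tensor side) hFG
  refine ⟨hM, hN, hF, hG, ?_, ?_, ?_, ?_⟩
  · exact RibbonTangle.EndoCat.isStrictMonoidal_functor hF (RibbonTangle.toHandle_tensor side)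
  · refine RibbonTangle.EndoCat.isStrictMonoidal_functor hG fun {m n} x y => ?_
    -- Both handles are written as images under $F$; then $G$ inherits compatibility with
    -- juxtaposition from $F$.
    conv_lhs => rw [← hFG m x, ← hFG n y, ← RibbonTangle.toHandle_tensor, hGF]
  · exact RibbonTangle.EndoCat.functor_comp_functor hF hG hGF
  · exact RibbonTangle.EndoCat.functor_comp_functor hG hF hFG
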